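/- **Theorem (Serre–Swan for algebra bundles).** Let $M$ be a compact Hausdorff smooth manifold and let $C^\infty(M)$ be the ring of smooth complex-valued functions on $M$, with complex conjugation as involution. All vector bundles over $M$ are smooth, complex and of finite rank; the rank is locally constant (it may differ between the components of $M$). All bundle morphisms cover the identity of $M$, and $\Gamma(M,B)$ is the $C^\infty(M)$-module of smooth sections of $B$. An *algebra bundle* over $M$ is a vector bundle $B$ with a vector bundle morphism $\mu\colon B\otimes B\to B$ such that $p\cdot q=\mu(p\otimes q)$ is associative on every fibre $B_x$ (no local triviality as an algebra bundle is required). It is *unital* if every fibre has a unit $1_x$. It is *involutive* if it carries a smooth fibrewise conjugate-linear map $J\colon B\to B$ with $J(p\cdot q)=J(q)\cdot J(p)$ and $J^2=1$. Morphisms are the vector bundle morphisms that are multiplicative on every fibre and, in the unital (involutive) case, map units to units (commute with $J$). A *$C^\infty(M)$-module algebra* is a $C^\infty(M)$-module with an associative $C^\infty(M)$-bilinear multiplication, not necessarily unital. It is *involutive* if it carries an additive map $a\mapsto a^*$ with $a^{**}=a$, $(ab)^*=b^*a^*$ and $(fa)^*=\bar f a^*$ for $f\in C^\infty(M)$. Morphisms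 are the $C^\infty(M)$-linear multiplicative maps that, in the unital (involutive) case, preserve the unit (the involution). With the pointwise operations, $\Gamma(M,B)$ is a (unital) (involutive) $C^\infty(M)$-module algebra for every (unital) (involutive) algebra bundle $B$, and a morphism $\varphi\colon B\to C$ induces $\Gamma(\varphi)\colon\Gamma(M,B)\to\Gamma(M,C)$, $\Gamma(\varphi)(s)(x)=\varphi(s(x))$. 1. In each of the four cases (algebra bundles; unital; involutive; unital and involutive) the module algebra $\Gamma(M,B)$ is finitely generated and projective as a $C^\infty(M)$-module, and the functor $\Gamma$ is an equivalence from the category of such bundles over $M$ to the category of those $C^\infty(M)$-module algebras of the same kind that are finitely generated and projective as $C^\infty(M)$-modules. In particular, the morphisms $\Gamma(M,B)\to\Gamma(M,C)$ correspond bijectively to the morphisms $B\to C$. 2. The fibrewise structure is recovered from sections. Let $B$ be a vector bundle over $M$. - For every associative $C^\infty(M)$-bilinear product $(s,t)\mapsto st$ on $\Gamma(M,B)$ there is a unique algebra bundle structure on $B$ with $s(x)\cdot t(x)=(st)(x)$ for all $s,t\in\Gamma(M,B)$, $x\in M$. - If $B$ is an algebra bundle and $e$ is a two-sided unit of $\Gamma(M,B)$,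 then $B$ is unital, with $1_x=e(x)$ for all $x\in M$. - If $B$ is an algebra bundle, then for every involution $s\mapsto s^*$ making $\Gamma(M,B)$ an involutive $C^\infty(M)$-module algebra there is a unique involution $J$ of the algebra bundle $B$ with $J(s(x))=s^*(x)$ for all $s\in\Gamma(M,B)$, $x\in M$. -/

import Mathlib

open scoped Manifold ContDiff TensorProduct
open CategoryTheory

universe u

noncomputable section

/-! ## The ring of smooth complex-valued functions -/

/-- `ℂ` is a smooth ring over `ℝ`. -/
instance Complex.instContMDiffRingReal : ContMDiffRing 𝓘(ℝ, ℂ) ∞ ℂ :=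
  { instNormedSpaceLieAddGroup with
    contMDiff_mul := by
      rw [contMDiff_iff]
      refine ⟨continuous_mul, fun x y => ?_⟩
      simp only [mfld_simps, chartAt_self_eq]
      rw [contDiffOn_univ]
      exact contDiff_mul }

section SmoothFunctions

variable {E : Type*} [NormedAddCommGroup E] [NormedSpace ℝ E]
  {H : Type*} [TopologicalSpace H] (I : ModelWithCorners ℝ E H)
  (M : Type u) [TopologicalSpace M] [ChartedSpace H M]

/-- The commutative ring `C^∞(M)` of smooth complex-valued functions on `M`. -/
abbrev SmoothFun : Type u := C^∞⟮I, M; 𝓘(ℝ, ℂ), ℂ⟯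

variable {I M}

/-- Pointwise complex conjugation on `C^∞(M)`. -/
instance SmoothFun.instStarRing : StarRing (SmoothFun I M) where
  star f := ⟨fun x => star (f x),
    (Complex.conjCLE.contDiff.contMDiff (n := ∞)).comp f.contMDiff⟩
  star_involutive f := by ext x; exact star_star (f x)
  star_mul f g := by ext x; exact star_mul (f x) (g x)
  star_add f g := by ext x; exact star_add (f x) (g x)

@[simp]
theorem SmoothFun.star_apply (f : SmoothFun I M) (x : M) : (star f) x = star (f x) := rfl

theorem linear_pi_apply_eq_sum {m n : ℕ} (g : (Fin m → ℂ) →ₗ[ℂ] (Fin n → ℂ)) (v : Fin m → ℂ) :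
    g v = ∑ a, v a • g (Pi.single a 1) := by
  conv_lhs => rw [pi_eq_sum_univ' v]
  rw [map_sum]
  refine Finset.sum_congr rfl fun a _ => ?_
  rw [map_smul]

/-- Applying a smooth family of linear maps to a smooth vector-valued function gives a smooth
function. -/
theorem contMDiffAt_linear_apply {m n : ℕ} {x₀ : M}
    (g : M → (Fin m → ℂ) →ₗ[ℂ] (Fin n → ℂ)) (w : M → Fin m → ℂ)
    (hg : ∀ v, ContMDiffAt I 𝓘(ℝ, Fin n → ℂ) ∞ (fun x => g x v) x₀)
    (hw : ContMDiffAt I 𝓘(ℝ, Fin m → ℂ) ∞ w x₀) :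
    ContMDiffAt I 𝓘(ℝ, Fin n → ℂ) ∞ (fun x => g x (w x)) x₀ := by
  simp only [fun x => linear_pi_apply_eq_sum (g x) (w x)]
  rw [contMDiffAt_pi_space]
  intro b
  simp only [Finset.sum_apply, Pi.smul_apply, smul_eq_mul]
  refine contMDiffAt_finsetSum fun a _ => ?_
  exact (contMDiffAt_pi_space.1 hw a).mul (contMDiffAt_pi_space.1 (hg _) b)

/-- The solution of a smooth family of linear equations that is the identity at one point is smooth
at that point. -/
theorem contMDiffAt_of_linear_eq {n : ℕ} {x₀ : M}
    (g : M → (Fin n → ℂ) →ₗ[ℂ] (Fin n → ℂ)) (w : M → Fin n → ℂ) (c : Fin n → ℂ)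
    (hg : ∀ v, ContMDiffAt I 𝓘(ℝ, Fin n → ℂ) ∞ (fun x => g x v) x₀)
    (hg₀ : g x₀ = LinearMap.id)
    (hw : ∀ᶠ x in nhds x₀, g x (w x) = c) :
    ContMDiffAt I 𝓘(ℝ, Fin n → ℂ) ∞ w x₀ := by
  let A := (Fin n → ℂ) →L[ℂ] (Fin n → ℂ)
  let L : Fin n → (Fin n → ℂ) →L[ℝ] A := fun a =>
    LinearMap.toContinuousLinearMap
      { toFun := fun z => (ContinuousLinearMap.proj a : (Fin n → ℂ) →L[ℂ] ℂ).smulRight z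
        map_add' := fun y z => by ext; simp [mul_add]
        map_smul' := fun r z => by ext; simp [mul_left_comm] }
  let G : M → A := fun x => ∑ a, L a (g x (Pi.single a 1))
  have hG : ContMDiffAt I 𝓘(ℝ, A) ∞ G x₀ := contMDiffAt_finsetSum fun a _ =>
    ((L a).contDiff.contMDiff (n := ∞)).contMDiffAt.comp x₀ (hg _)
  have hGg : ∀ x v, G x v = g x v := fun x v => by
    rw [linear_pi_apply_eq_sum]
    change (∑ a, L a (g x (Pi.single a 1)) : (Fin n → ℂ) →L[ℂ] (Fin n → ℂ)) v = _
    rw [sum_apply]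
    rfl
  have hG₀ : G x₀ = 1 := by
    ext1 v
    rw [hGg, hg₀]
    rfl
  have hinv : ContMDiffAt I 𝓘(ℝ, A) ∞ (fun x => Ring.inverse (G x)) x₀ :=
    ContMDiffAt.comp x₀ (g := Ring.inverse) (I' := 𝓘(ℝ, A))
      (by rw [hG₀]; exact (contDiffAt_ringInverse ℝ (1 : Aˣ)).contMDiffAt) hG
  let ev : A →L[ℝ] (Fin n → ℂ) := LinearMap.toContinuousLinearMap
      { toFun := fun T => T c
        map_add' := fun y z => by simp
        map_smul' := fun r z => by simp }
  have := ((ev.contDiff.contMDiff (n := ∞)).contMDiffAt.comp x₀ hinv)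
  refine this.congr_of_eventuallyEq ?_
  have hu : ∀ᶠ x in nhds x₀, IsUnit (G x) :=
    hG.continuousAt.eventually (by rw [hG₀]; exact Units.isOpen.mem_nhds isUnit_one)
  filter_upwards [hw, hu] with x hx hux
  change w x = Ring.inverse (G x) c
  rw [← hx, ← hGg, ← mul_apply_eq_comp, Ring.inverse_mul_cancel _ hux]
  rfl

end SmoothFunctions

/-! ## Smooth vector bundles -/

section VectorBundles

variable {E : Type*} [NormedAddCommGroup E] [NormedSpace ℝ E]
  {H : Type*} [TopologicalSpace H]

/-- A smooth complex vector bundle of finite rank over `M`: a family of complex vector spaces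
`fiber x`, `x ∈ M`, with an atlas of local trivialisations. The trivialisation with index `i` lives
over the open set `dom i` and identifies `fiber x` with `ℂ ^ rank i` for `x ∈ dom i`, through the
mutually inverse linear maps `triv i x` and `symm i x` (for `x ∉ dom i` their values carry no
information); the coordinate changes are smooth. As the rank belongs to the trivialisation,
it is only locally constant, and may differ between the components of `M`. The topology and the
smooth structure of the total space are the ones for which the local trivialisations are
diffeomorphisms. -/
structure SmoothVB (I : ModelWithCorners ℝ E H) (M : Type u) [TopologicalSpace M]
    [ChartedSpace H M] : Type (u + 1) where
  /-- The fibres. -/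
  fiber : M → Type u
  [addCommGroup : ∀ x, AddCommGroup (fiber x)]
  [module : ∀ x, Module ℂ (fiber x)]
  /-- Indices of the local trivialisations. -/
  Idx : Type u
  /-- Domains of the local trivialisations. -/
  dom : Idx → Set M
  isOpen_dom : ∀ i, IsOpen (dom i)
  exists_mem_dom : ∀ x, ∃ i, x ∈ dom i
  /-- The rank over `dom i`. -/
  rank : Idx → ℕ
  /-- The local trivialisations, fibre by fibre. -/
  triv : ∀ (i : Idx) (x : M), fiber x →ₗ[ℂ] (Fin (rank i) → ℂ)
  /-- The inverses of the local trivialisations, fibre by fibre. -/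
  symm : ∀ (i : Idx) (x : M), (Fin (rank i) → ℂ) →ₗ[ℂ] fiber x
  symm_triv : ∀ i, ∀ x ∈ dom i, ∀ p, symm i x (triv i x p) = p
  triv_symm : ∀ i, ∀ x ∈ dom i, ∀ v, triv i x (symm i x v) = v
  /-- The coordinate changes are smooth. -/
  smooth_coordChange : ∀ i j v, ContMDiffOn I 𝓘(ℝ, Fin (rank j) → ℂ) ∞
    (fun x => triv j x (symm i x v)) (dom i ∩ dom j)

attribute [instance] SmoothVB.addCommGroup SmoothVB.module

variable {I : ModelWithCorners ℝ E H} {M : Type u} [TopologicalSpace M] [ChartedSpace H M]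

/-- Morphisms of smooth vector bundles over the identity of `M`: fibrewise linear maps that are
smooth in all local trivialisations. -/
@[ext]
structure VBHom (B C : SmoothVB I M) : Type u where
  /-- The linear maps between the fibres. -/
  toFun : ∀ x, B.fiber x →ₗ[ℂ] C.fiber x
  smooth : ∀ i j v, ContMDiffOn I 𝓘(ℝ, Fin (C.rank j) → ℂ) ∞
    (fun x => C.triv j x (toFun x (B.symm i x v))) (B.dom i ∩ C.dom j)

/-- The space `Γ(M, B)` of smooth sections. -/
@[ext]
structure SmoothSection (B : SmoothVB I M) : Type u where
  /-- The underlying section. -/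
  toFun : ∀ x, B.fiber x
  smooth : ∀ i, ContMDiffOn I 𝓘(ℝ, Fin (B.rank i) → ℂ) ∞
    (fun x => B.triv i x (toFun x)) (B.dom i)

instance (B : SmoothVB I M) : DFunLike (SmoothSection B) M B.fiber where
  coe := SmoothSection.toFun
  coe_injective := fun _ _ h => SmoothSection.ext h

namespace SmoothSection

variable {B : SmoothVB I M}

theorem smoothAt (s : SmoothSection B) {i : B.Idx} {x : M} (hx : x ∈ B.dom i) :
    ContMDiffAt I 𝓘(ℝ, Fin (B.rank i) → ℂ) ∞ (fun y => B.triv i y (s y)) x :=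
  (s.smooth i).contMDiffAt ((B.isOpen_dom i).mem_nhds hx)

instance : Zero (SmoothSection B) :=
  ⟨⟨0, fun i => by simpa using contMDiffOn_const⟩⟩

instance : Add (SmoothSection B) :=
  ⟨fun s t => ⟨fun x => s x + t x, fun i => by
    simp only [map_add]
    exact (s.smooth i).add (t.smooth i)⟩⟩

instance : Neg (SmoothSection B) :=
  ⟨fun s => ⟨fun x => -s x, fun i => by
    simp only [map_neg]
    exact (s.smooth i).neg⟩⟩

instance : Sub (SmoothSection B) :=
  ⟨fun s t => ⟨fun x => s x - t x, fun i => by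
    simp only [map_sub]
    exact (s.smooth i).sub (t.smooth i)⟩⟩

theorem smooth_smul (f : SmoothFun I M) (s : SmoothSection B) (i : B.Idx) :
    ContMDiffOn I 𝓘(ℝ, Fin (B.rank i) → ℂ) ∞
      (fun x => B.triv i x (f x • s x)) (B.dom i) := by
  simp only [map_smul]
  rw [contMDiffOn_pi_space]
  intro a
  exact (f.contMDiff.contMDiffOn).mul (contMDiffOn_pi_space.1 (s.smooth i) a)

instance : SMul (SmoothFun I M) (SmoothSection B) :=
  ⟨fun f s => ⟨fun x => f x • s x, smooth_smul f s⟩⟩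

@[simp] theorem zero_apply (x : M) : (0 : SmoothSection B) x = 0 := rfl
@[simp] theorem add_apply (s t : SmoothSection B) (x : M) : (s + t) x = s x + t x := rfl
@[simp] theorem neg_apply (s : SmoothSection B) (x : M) : (-s) x = -s x := rfl
@[simp] theorem sub_apply (s t : SmoothSection B) (x : M) : (s - t) x = s x - t x := rfl
@[simp] theorem smul_apply (f : SmoothFun I M) (s : SmoothSection B) (x : M) :
    (f • s) x = f x • s x := rfl

instance : AddCommGroup (SmoothSection B) where
  add_assoc s t r := DFunLike.ext _ _ fun x => add_assoc (s x) (t x) (r x)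
  zero_add s := DFunLike.ext _ _ fun x => zero_add (s x)
  add_zero s := DFunLike.ext _ _ fun x => add_zero (s x)
  neg_add_cancel s := DFunLike.ext _ _ fun x => neg_add_cancel (s x)
  add_comm s t := DFunLike.ext _ _ fun x => add_comm (s x) (t x)
  sub_eq_add_neg s t := DFunLike.ext _ _ fun x => sub_eq_add_neg (s x) (t x)
  nsmul := nsmulRec
  zsmul := zsmulRec

/-- The module structure of `Γ(M, B)` over `C^∞(M)`, pointwise. -/
instance : Module (SmoothFun I M) (SmoothSection B) where
  one_smul s := DFunLike.ext _ _ fun x => one_smul ℂ (s x)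
  mul_smul f g s := DFunLike.ext _ _ fun x => mul_smul (f x) (g x) (s x)
  smul_zero f := DFunLike.ext _ _ fun x => smul_zero (f x)
  smul_add f s t := DFunLike.ext _ _ fun x => smul_add (f x) (s x) (t x)
  add_smul f g s := DFunLike.ext _ _ fun x => add_smul (f x) (g x) (s x)
  zero_smul s := DFunLike.ext _ _ fun x => zero_smul ℂ (s x)

end SmoothSection

namespace VBHom

variable {B C D : SmoothVB I M}

theorem smoothAt_apply (φ : VBHom B C) (s : ∀ x, B.fiber x) {i : B.Idx} {j : C.Idx} {x : M}
    (hi : x ∈ B.dom i) (hj : x ∈ C.dom j)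
    (hs : ContMDiffAt I 𝓘(ℝ, Fin (B.rank i) → ℂ) ∞ (fun y => B.triv i y (s y)) x) :
    ContMDiffAt I 𝓘(ℝ, Fin (C.rank j) → ℂ) ∞ (fun y => C.triv j y (φ.toFun y (s y))) x := by
  have h := contMDiffAt_linear_apply (I := I) (x₀ := x)
    (fun y => C.triv j y ∘ₗ φ.toFun y ∘ₗ B.symm i y) (fun y => B.triv i y (s y))
    (fun v => (φ.smooth i j v).contMDiffAt
      (((B.isOpen_dom i).inter (C.isOpen_dom j)).mem_nhds ⟨hi, hj⟩)) hs
  refine h.congr_of_eventuallyEq ?_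
  filter_upwards [(B.isOpen_dom i).mem_nhds hi] with y hy
  simp [B.symm_triv i y hy]

/-- The identity of a vector bundle. -/
protected def id (B : SmoothVB I M) : VBHom B B where
  toFun _ := LinearMap.id
  smooth i j v := B.smooth_coordChange i j v

/-- Composition of morphisms of vector bundles. -/
protected def comp (ψ : VBHom C D) (φ : VBHom B C) : VBHom B D where
  toFun x := ψ.toFun x ∘ₗ φ.toFun x
  smooth i k v x hx := by
    obtain ⟨j, hj⟩ := C.exists_mem_dom x
    exact (ψ.smoothAt_apply (fun y => φ.toFun y (B.symm i y v)) hj hx.2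
      ((φ.smooth i j v).contMDiffAt
        (((B.isOpen_dom i).inter (C.isOpen_dom j)).mem_nhds ⟨hx.1, hj⟩))).contMDiffWithinAt

/-- The map on sections induced by a morphism of vector bundles, `(Γ(φ) s)(x) = φ (s x)`. -/
def mapSections (φ : VBHom B C) : SmoothSection B →ₗ[SmoothFun I M] SmoothSection C where
  toFun s :=
    { toFun := fun x => φ.toFun x (s x)
      smooth := fun j x hx => by
        obtain ⟨i, hi⟩ := B.exists_mem_dom x
        exact (φ.smoothAt_apply s hi hx (s.smoothAt hi)).contMDiffWithinAt }
  map_add' s t := DFunLike.ext _ _ fun x => map_add (φ.toFun x) (s x) (t x)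
  map_smul' f s := DFunLike.ext _ _ fun x => map_smul (φ.toFun x) (f x) (s x)

@[simp]
theorem mapSections_apply (φ : VBHom B C) (s : SmoothSection B) (x : M) :
    φ.mapSections s x = φ.toFun x (s x) := rfl

end VBHom

/-! ## Algebra structures on a vector bundle -/

/-- An algebra structure on a vector bundle `B`: a vector bundle morphism `μ : B ⊗ B → B`
that is associative on each fibre. Smoothness of `μ` is expressed in the local trivialisations
of `B` and the induced ones of `B ⊗ B`, whose fibres `ℂⁿ ⊗ ℂⁿ` are spanned by the `v ⊗ w`. -/
@[ext]
class AlgebraBundleStr (B : SmoothVB I M) where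
  /-- The multiplication. -/
  mu : ∀ x, B.fiber x ⊗[ℂ] B.fiber x →ₗ[ℂ] B.fiber x
  smooth_mu : ∀ i v w, ContMDiffOn I 𝓘(ℝ, Fin (B.rank i) → ℂ) ∞
    (fun x => B.triv i x (mu x (B.symm i x v ⊗ₜ B.symm i x w))) (B.dom i)
  mu_assoc : ∀ x (p q r : B.fiber x), mu x (p ⊗ₜ mu x (q ⊗ₜ r)) = mu x (mu x (p ⊗ₜ q) ⊗ₜ r)

/-- The product `p · q = μ (p ⊗ q)` in a fibre of an algebra bundle. -/
def fiberMul {B : SmoothVB I M} [AlgebraBundleStr B] {x : M} (p q : B.fiber x) : B.fiber x :=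
  AlgebraBundleStr.mu x (p ⊗ₜ[ℂ] q)

/-- A unital algebra bundle: every fibre has a (two-sided) unit. -/
@[ext]
class UnitalBundleStr (B : SmoothVB I M) [AlgebraBundleStr B] where
  /-- The units of the fibres. -/
  one : ∀ x, B.fiber x
  one_mul : ∀ x (p : B.fiber x), fiberMul (one x) p = p
  mul_one : ∀ x (p : B.fiber x), fiberMul p (one x) = p

/-- An involution on an algebra bundle `B`: a morphism `J` from `B` to the conjugate bundle with the
opposite multiplication (so `J` is conjugate-linear, smooth and reverses products) such that
`J² = 1`. -/
@[ext]
class InvolutiveBundleStr (B : SmoothVB I M) [AlgebraBundleStr B] where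
  /-- The involution. -/
  J : ∀ x, B.fiber x →ₛₗ[starRingEnd ℂ] B.fiber x
  smooth_J : ∀ i v, ContMDiffOn I 𝓘(ℝ, Fin (B.rank i) → ℂ) ∞
    (fun x => B.triv i x (J x (B.symm i x v))) (B.dom i)
  J_mul : ∀ x (p q : B.fiber x), J x (fiberMul p q) = fiberMul (J x q) (J x p)
  J_J : ∀ x (p : B.fiber x), J x (J x p) = p

section FiberMul

variable {B : SmoothVB I M} [AlgebraBundleStr B]

theorem fiberMul_assoc {x : M} (p q r : B.fiber x) :
    fiberMul (fiberMul p q) r = fiberMul p (fiberMul q r) :=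
  (AlgebraBundleStr.mu_assoc x p q r).symm

/-- The fibre multiplication as a bilinear map. -/
def fiberMulₗ (B : SmoothVB I M) [AlgebraBundleStr B] (x : M) :
    B.fiber x →ₗ[ℂ] B.fiber x →ₗ[ℂ] B.fiber x :=
  TensorProduct.curry (AlgebraBundleStr.mu x)

theorem fiberMul_eq {x : M} (p q : B.fiber x) : fiberMul p q = fiberMulₗ B x p q := rfl

theorem smoothAt_fiberMul (s t : ∀ x, B.fiber x) {i : B.Idx} {x : M} (hi : x ∈ B.dom i)
    (hs : ContMDiffAt I 𝓘(ℝ, Fin (B.rank i) → ℂ) ∞ (fun y => B.triv i y (s y)) x)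
    (ht : ContMDiffAt I 𝓘(ℝ, Fin (B.rank i) → ℂ) ∞ (fun y => B.triv i y (t y)) x) :
    ContMDiffAt I 𝓘(ℝ, Fin (B.rank i) → ℂ) ∞
      (fun y => B.triv i y (fiberMul (s y) (t y))) x := by
  have h₁ : ∀ v, ContMDiffAt I 𝓘(ℝ, Fin (B.rank i) → ℂ) ∞
      (fun y => B.triv i y (fiberMulₗ B y (B.symm i y v) (t y))) x := by
    intro v
    refine (contMDiffAt_linear_apply (I := I) (x₀ := x)
      (fun y => B.triv i y ∘ₗ fiberMulₗ B y (B.symm i y v) ∘ₗ B.symm i y)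
      (fun y => B.triv i y (t y))
      (fun w => (AlgebraBundleStr.smooth_mu i v w).contMDiffAt ((B.isOpen_dom i).mem_nhds hi))
      ht).congr_of_eventuallyEq ?_
    filter_upwards [(B.isOpen_dom i).mem_nhds hi] with y hy
    simp [B.symm_triv i y hy]
  refine (contMDiffAt_linear_apply (I := I) (x₀ := x)
    (fun y => B.triv i y ∘ₗ (fiberMulₗ B y).flip (t y) ∘ₗ B.symm i y)
    (fun y => B.triv i y (s y)) h₁ hs).congr_of_eventuallyEq ?_
  filter_upwards [(B.isOpen_dom i).mem_nhds hi] with y hy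
  simp [B.symm_triv i y hy, fiberMul_eq]

theorem smoothAt_J [InvolutiveBundleStr B] (s : ∀ x, B.fiber x) {i : B.Idx} {x : M}
    (hi : x ∈ B.dom i)
    (hs : ContMDiffAt I 𝓘(ℝ, Fin (B.rank i) → ℂ) ∞ (fun y => B.triv i y (s y)) x) :
    ContMDiffAt I 𝓘(ℝ, Fin (B.rank i) → ℂ) ∞
      (fun y => B.triv i y (InvolutiveBundleStr.J y (s y))) x := by
  have hs' : ContMDiffAt I 𝓘(ℝ, Fin (B.rank i) → ℂ) ∞
      (fun y => star (B.triv i y (s y))) x := by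
    rw [contMDiffAt_pi_space] at hs ⊢
    intro a
    exact (Complex.conjCLE.contDiff.contMDiff (n := ∞)).contMDiffAt.comp x (hs a)
  refine (contMDiffAt_linear_apply (I := I) (x₀ := x)
    (fun y =>
      { toFun := fun v => B.triv i y (InvolutiveBundleStr.J y (B.symm i y (star v)))
        map_add' := fun v w => by simp
        map_smul' := fun c v => by simp })
    (fun y => star (B.triv i y (s y)))
    (fun v => (InvolutiveBundleStr.smooth_J i (star v)).contMDiffAt
      ((B.isOpen_dom i).mem_nhds hi)) hs').congr_of_eventuallyEq ?_
  filter_upwards [(B.isOpen_dom i).mem_nhds hi] with y hy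
  simp [B.symm_triv i y hy]

/-- The units of the fibres of a unital algebra bundle form a smooth section. -/
theorem smoothAt_one [UnitalBundleStr B] {i : B.Idx} {x : M} (hi : x ∈ B.dom i) :
    ContMDiffAt I 𝓘(ℝ, Fin (B.rank i) → ℂ) ∞
      (fun y => B.triv i y (UnitalBundleStr.one y)) x := by
  refine contMDiffAt_of_linear_eq
    (fun y => B.triv i y ∘ₗ
      (fiberMulₗ B y).flip (B.symm i y (B.triv i x (UnitalBundleStr.one x))) ∘ₗ B.symm i y)
    (fun y => B.triv i y (UnitalBundleStr.one y)) (B.triv i x (UnitalBundleStr.one x))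
    (fun v => (AlgebraBundleStr.smooth_mu i v _).contMDiffAt ((B.isOpen_dom i).mem_nhds hi))
    ?_ ?_
  · ext1 a
    ext1
    simp [B.symm_triv i x hi, ← fiberMul_eq, UnitalBundleStr.mul_one, B.triv_symm i x hi]
  · filter_upwards [(B.isOpen_dom i).mem_nhds hi] with y hy
    simp [B.symm_triv i y hy, ← fiberMul_eq, UnitalBundleStr.one_mul, B.triv_symm i y hy]

end FiberMul

/-! ## Algebras of sections -/

namespace SmoothSection

variable {B : SmoothVB I M} [AlgebraBundleStr B]

/-- The pointwise product of sections. -/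
instance : Mul (SmoothSection B) :=
  ⟨fun s t => ⟨fun x => fiberMul (s x) (t x), fun _ _ hx =>
    (smoothAt_fiberMul s t hx (s.smoothAt hx) (t.smoothAt hx)).contMDiffWithinAt⟩⟩

@[simp] theorem mul_apply (s t : SmoothSection B) (x : M) : (s * t) x = fiberMul (s x) (t x) := rfl

instance : NonUnitalRing (SmoothSection B) where
  left_distrib s t r := DFunLike.ext _ _ fun x => by simp [fiberMul_eq]
  right_distrib s t r := DFunLike.ext _ _ fun x => by simp [fiberMul_eq]
  zero_mul s := DFunLike.ext _ _ fun x => by simp [fiberMul_eq]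
  mul_zero s := DFunLike.ext _ _ fun x => by simp [fiberMul_eq]
  mul_assoc s t r := DFunLike.ext _ _ fun x => fiberMul_assoc (s x) (t x) (r x)

instance : IsScalarTower (SmoothFun I M) (SmoothSection B) (SmoothSection B) where
  smul_assoc f s t := DFunLike.ext _ _ fun x => by simp [fiberMul_eq]

instance : SMulCommClass (SmoothFun I M) (SmoothSection B) (SmoothSection B) where
  smul_comm f s t := DFunLike.ext _ _ fun x => by simp [fiberMul_eq]

/-- The unit section. -/
instance [UnitalBundleStr B] : One (SmoothSection B) :=
  ⟨⟨UnitalBundleStr.one, fun _ _ hx => (smoothAt_one hx).contMDiffWithinAt⟩⟩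

@[simp] theorem one_apply [UnitalBundleStr B] (x : M) :
    (1 : SmoothSection B) x = UnitalBundleStr.one x := rfl

instance [UnitalBundleStr B] : Ring (SmoothSection B) where
  __ := (inferInstance : NonUnitalRing (SmoothSection B))
  one_mul s := DFunLike.ext _ _ fun x => UnitalBundleStr.one_mul x (s x)
  mul_one s := DFunLike.ext _ _ fun x => UnitalBundleStr.mul_one x (s x)

instance [UnitalBundleStr B] : Algebra (SmoothFun I M) (SmoothSection B) :=
  Algebra.ofModule (fun f s t => smul_mul_assoc f s t) (fun f s t => mul_smul_comm f s t)

/-- The pointwise involution of sections. -/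
instance [InvolutiveBundleStr B] : Star (SmoothSection B) :=
  ⟨fun s => ⟨fun x => InvolutiveBundleStr.J x (s x), fun _ _ hx =>
    (smoothAt_J s hx (s.smoothAt hx)).contMDiffWithinAt⟩⟩

@[simp] theorem star_apply [InvolutiveBundleStr B] (s : SmoothSection B) (x : M) :
    (star s) x = InvolutiveBundleStr.J x (s x) := rfl

instance [InvolutiveBundleStr B] : StarRing (SmoothSection B) where
  star_involutive s := DFunLike.ext _ _ fun x => InvolutiveBundleStr.J_J x (s x)
  star_mul s t := DFunLike.ext _ _ fun x => InvolutiveBundleStr.J_mul x (s x) (t x)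
  star_add s t := DFunLike.ext _ _ fun x => map_add (InvolutiveBundleStr.J x) (s x) (t x)

instance [InvolutiveBundleStr B] : StarModule (SmoothFun I M) (SmoothSection B) where
  star_smul f s := DFunLike.ext _ _ fun x => by simp

end SmoothSection

end VectorBundles

/-! ## Categories of algebra bundles -/

section BundleCategories

variable {E : Type*} [NormedAddCommGroup E] [NormedSpace ℝ E]
  {H : Type*} [TopologicalSpace H]
  (I : ModelWithCorners ℝ E H) (M : Type u) [TopologicalSpace M] [ChartedSpace H M]

/-- Algebra bundles over `M`. -/
structure AlgB : Type (u + 1) where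
  /-- The underlying vector bundle. -/
  bundle : SmoothVB I M
  [alg : AlgebraBundleStr bundle]

/-- Unital algebra bundles over `M`. -/
structure UAlgB : Type (u + 1) where
  /-- The underlying vector bundle. -/
  bundle : SmoothVB I M
  [alg : AlgebraBundleStr bundle]
  [unital : UnitalBundleStr bundle]

/-- Involutive algebra bundles over `M`. -/
structure StarAlgB : Type (u + 1) where
  /-- The underlying vector bundle. -/
  bundle : SmoothVB I M
  [alg : AlgebraBundleStr bundle]
  [inv : InvolutiveBundleStr bundle]

/-- Unital involutive algebra bundles over `M`. -/
structure UStarAlgB : Type (u + 1) where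
  /-- The underlying vector bundle. -/
  bundle : SmoothVB I M
  [alg : AlgebraBundleStr bundle]
  [unital : UnitalBundleStr bundle]
  [inv : InvolutiveBundleStr bundle]

attribute [instance] AlgB.alg UAlgB.alg UAlgB.unital StarAlgB.alg StarAlgB.inv
  UStarAlgB.alg UStarAlgB.unital UStarAlgB.inv

variable {I M}

/-- Algebra bundle morphisms: vector bundle morphisms that are multiplicative on each fibre. -/
@[ext]
structure AlgBHom (B C : SmoothVB I M) [AlgebraBundleStr B] [AlgebraBundleStr C]
    extends VBHom B C where
  map_mul : ∀ x p q, toFun x (fiberMul p q) = fiberMul (toFun x p) (toFun x q)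

/-- Morphisms of unital algebra bundles. -/
@[ext]
structure UAlgBHom (B C : SmoothVB I M) [AlgebraBundleStr B] [AlgebraBundleStr C]
    [UnitalBundleStr B] [UnitalBundleStr C] extends AlgBHom B C where
  map_one : ∀ x, toFun x (UnitalBundleStr.one x) = UnitalBundleStr.one x

/-- Morphisms of involutive algebra bundles. -/
@[ext]
structure StarAlgBHom (B C : SmoothVB I M) [AlgebraBundleStr B] [AlgebraBundleStr C]
    [InvolutiveBundleStr B] [InvolutiveBundleStr C] extends AlgBHom B C where
  map_J : ∀ x p, toFun x (InvolutiveBundleStr.J x p) = InvolutiveBundleStr.J x (toFun x p)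

/-- Morphisms of unital involutive algebra bundles. -/
@[ext]
structure UStarAlgBHom (B C : SmoothVB I M) [AlgebraBundleStr B] [AlgebraBundleStr C]
    [UnitalBundleStr B] [UnitalBundleStr C] [InvolutiveBundleStr B] [InvolutiveBundleStr C]
    extends UAlgBHom B C, StarAlgBHom B C

instance : Category.{u} (AlgB I M) where
  Hom B C := AlgBHom B.bundle C.bundle
  id B := { VBHom.id B.bundle with map_mul := fun _ _ _ => rfl }
  comp φ ψ := { ψ.toVBHom.comp φ.toVBHom with
    map_mul := fun x p q => by simp [VBHom.comp, φ.map_mul, ψ.map_mul] }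

instance : Category.{u} (UAlgB I M) where
  Hom B C := UAlgBHom B.bundle C.bundle
  id B := { VBHom.id B.bundle with
    map_mul := fun _ _ _ => rfl
    map_one := fun _ => rfl }
  comp φ ψ := { ψ.toVBHom.comp φ.toVBHom with
    map_mul := fun x p q => by simp [VBHom.comp, φ.map_mul, ψ.map_mul]
    map_one := fun x => by simp [VBHom.comp, φ.map_one, ψ.map_one] }

instance : Category.{u} (StarAlgB I M) where
  Hom B C := StarAlgBHom B.bundle C.bundle
  id B := { VBHom.id B.bundle with
    map_mul := fun _ _ _ => rfl
    map_J := fun _ _ => rfl }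
  comp φ ψ := { ψ.toVBHom.comp φ.toVBHom with
    map_mul := fun x p q => by simp [VBHom.comp, φ.map_mul, ψ.map_mul]
    map_J := fun x p => by simp [VBHom.comp, φ.map_J, ψ.map_J] }

instance : Category.{u} (UStarAlgB I M) where
  Hom B C := UStarAlgBHom B.bundle C.bundle
  id B := { VBHom.id B.bundle with
    map_mul := fun _ _ _ => rfl
    map_one := fun _ => rfl
    map_J := fun _ _ => rfl }
  comp φ ψ := { ψ.toVBHom.comp φ.toVBHom with
    map_mul := fun x p q => by simp [VBHom.comp, φ.map_mul, ψ.map_mul]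
    map_one := fun x => by simp [VBHom.comp, φ.map_one, ψ.map_one]
    map_J := fun x p => by simp [VBHom.comp, φ.map_J, ψ.map_J] }

end BundleCategories

/-! ## Categories of module algebras -/

section ModuleAlgebras

variable (R : Type u) [CommRing R]

/-- `R`-module algebras: `R`-modules with an associative `R`-bilinear multiplication, not necessarily
unital. (For unital ones, see `AlgCat R`.) -/
structure ModAlg : Type (u + 1) where
  /-- The underlying type. -/
  carrier : Type u
  [ring : NonUnitalRing carrier]
  [module : Module R carrier]
  [tower : IsScalarTower R carrier carrier]
  [comm : SMulCommClass R carrier carrier]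

attribute [instance] ModAlg.ring ModAlg.module ModAlg.tower ModAlg.comm

instance : Category.{u} (ModAlg R) where
  Hom A B := A.carrier →ₙₐ[R] B.carrier
  id A := NonUnitalAlgHom.id R A.carrier
  comp f g := g.comp f

variable [StarRing R]

/-- Involutive `R`-module algebras, where `R` is a commutative ring with involution. -/
structure StarModAlg : Type (u + 1) where
  /-- The underlying type. -/
  carrier : Type u
  [ring : NonUnitalRing carrier]
  [module : Module R carrier]
  [tower : IsScalarTower R carrier carrier]
  [comm : SMulCommClass R carrier carrier]
  [starRing : StarRing carrier]
  [starModule : StarModule R carrier]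

attribute [instance] StarModAlg.ring StarModAlg.module StarModAlg.tower StarModAlg.comm
  StarModAlg.starRing StarModAlg.starModule

instance : Category.{u} (StarModAlg R) where
  Hom A B := A.carrier →⋆ₙₐ[R] B.carrier
  id A := NonUnitalStarAlgHom.id R A.carrier
  comp f g := g.comp f

/-- Unital involutive `R`-module algebras, where `R` is a commutative ring with involution. -/
structure UStarModAlg : Type (u + 1) where
  /-- The underlying type. -/
  carrier : Type u
  [ring : Ring carrier]
  [algebra : Algebra R carrier]
  [starRing : StarRing carrier]
  [starModule : StarModule R carrier]

attribute [instance] UStarModAlg.ring UStarModAlg.algebra UStarModAlg.starRing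
  UStarModAlg.starModule

instance : Category.{u} (UStarModAlg R) where
  Hom A B := A.carrier →⋆ₐ[R] B.carrier
  id A := StarAlgHom.id R A.carrier
  comp f g := g.comp f

/-- A finitely generated projective module. -/
def IsFGP (R A : Type u) [CommRing R] [AddCommGroup A] [Module R A] : Prop :=
  Module.Finite R A ∧ Module.Projective R A

/-- Module algebras that are finitely generated projective as modules. -/
def ModAlg.fgp (R : Type u) [CommRing R] : ObjectProperty (ModAlg R) :=
  fun A => IsFGP R A.carrier

/-- Unital algebras that are finitely generated projective as modules. -/
def AlgCat.fgp (R : Type u) [CommRing R] : ObjectProperty (AlgCat.{u} R) :=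
  fun A => IsFGP R A

/-- Involutive module algebras that are finitely generated projective as modules. -/
def StarModAlg.fgp (R : Type u) [CommRing R] [StarRing R] : ObjectProperty (StarModAlg R) :=
  fun A => IsFGP R A.carrier

/-- Unital involutive module algebras that are finitely generated projective as modules. -/
def UStarModAlg.fgp (R : Type u) [CommRing R] [StarRing R] : ObjectProperty (UStarModAlg R) :=
  fun A => IsFGP R A.carrier

end ModuleAlgebras

/-! ## The section functors -/

section SectionFunctors

variable {E : Type*} [NormedAddCommGroup E] [NormedSpace ℝ E]
  {H : Type*} [TopologicalSpace H] {I : ModelWithCorners ℝ E H}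
  {M : Type u} [TopologicalSpace M] [ChartedSpace H M]

/-- The homomorphism of module algebras induced by an algebra bundle morphism. -/
def AlgBHom.mapSections {B C : SmoothVB I M} [AlgebraBundleStr B] [AlgebraBundleStr C]
    (φ : AlgBHom B C) : SmoothSection B →ₙₐ[SmoothFun I M] SmoothSection C where
  toFun := φ.toVBHom.mapSections
  map_smul' f s := map_smul φ.toVBHom.mapSections f s
  map_zero' := map_zero φ.toVBHom.mapSections
  map_add' s t := map_add φ.toVBHom.mapSections s t
  map_mul' s t := DFunLike.ext _ _ fun x => φ.map_mul x (s x) (t x)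

/-- The homomorphism of unital algebras induced by a unital algebra bundle morphism. -/
def UAlgBHom.mapSections {B C : SmoothVB I M} [AlgebraBundleStr B] [AlgebraBundleStr C]
    [UnitalBundleStr B] [UnitalBundleStr C]
    (φ : UAlgBHom B C) : SmoothSection B →ₐ[SmoothFun I M] SmoothSection C :=
  AlgHom.ofLinearMap φ.toVBHom.mapSections
    (DFunLike.ext _ _ fun x => φ.map_one x)
    (fun s t => DFunLike.ext _ _ fun x => φ.map_mul x (s x) (t x))

variable (I M)

/-- The functor `Γ` from algebra bundles to `C^∞(M)`-module algebras. -/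
def sectionFunctor : AlgB I M ⥤ ModAlg (SmoothFun I M) where
  obj B := { carrier := SmoothSection B.bundle }
  map φ := AlgBHom.mapSections φ

/-- The functor `Γ` from unital algebra bundles to unital `C^∞(M)`-module algebras. -/
def sectionFunctorU : UAlgB I M ⥤ AlgCat.{u} (SmoothFun I M) where
  obj B := AlgCat.of (SmoothFun I M) (SmoothSection B.bundle)
  map φ := AlgCat.ofHom (UAlgBHom.mapSections φ)

/-- The functor `Γ` from involutive algebra bundles to involutive `C^∞(M)`-module algebras. -/
def sectionFunctorStar : StarAlgB I M ⥤ StarModAlg (SmoothFun I M) where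
  obj B := { carrier := SmoothSection B.bundle }
  map φ :=
    { AlgBHom.mapSections φ.toAlgBHom with
      map_star' := fun s => DFunLike.ext _ _ fun x => φ.map_J x (s x) }

/-- The functor `Γ` from unital involutive algebra bundles to unital involutive
`C^∞(M)`-module algebras. -/
def sectionFunctorUStar : UStarAlgB I M ⥤ UStarModAlg (SmoothFun I M) where
  obj B := { carrier := SmoothSection B.bundle }
  map φ :=
    { UAlgBHom.mapSections φ.toUAlgBHom with
      map_star' := fun s => DFunLike.ext _ _ fun x => φ.map_J x (s x) }

end SectionFunctors

end

/-!
The proof rests on finite global frames. On a compact manifold, finitely many local frames of a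
vector bundle `B`, cut off by bump functions, give sections `sₖ` of `B`, and the cut-off local
coordinates give smooth fibrewise functionals `θₖ`, with `p = ∑ₖ θₖ(p) sₖ(x)` for every `p` in the
fibre at `x` (`SmoothVB.nonempty_frame`). On sections this reads `s = ∑ₖ θₖ(s) sₖ`, a dual basis:
`Γ(M, B)` is finitely generated and projective (`SmoothVB.Frame.isFGP`), and sections pass through
every point of `B`.

It also makes every `C^∞(M)`-linear, bilinear or conjugate-linear operation on sections pointwise:
from `T s = ∑ₖ θₖ(s) T sₖ`, the value of `T s` at `x` is the image of `s(x)` under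
`p ↦ ∑ₖ θₖ(p) (T sₖ)(x)`, a formula which is visibly smooth
(with `θₖ(p)` conjugated if `T` is conjugate-linear). Thus linear maps of sections come from
bundle morphisms, products from fibrewise products and involutions from fibrewise involutions, and
all identities may be checked on sections. In particular the section functors are full and faithful.

For essential surjectivity, a finitely generated projective module is the image of an idempotent
matrix over `C^∞(M)`, that is, of a smooth family `P` of idempotents of `ℂ^κ`. The ranges of the
`P x` form a vector bundle: for `x` near `x₀`, the map `P x₀ * P x + (1 - P x₀) * (1 - P x)` is
invertible and carries the range of `P x` onto that of `P x₀` (`IdempotentFamily.bundle`). The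
sections of this bundle are the smooth functions `w` with `P w = w`, so they form the given module
(`IsFGP.exists_linearEquiv_smoothSection`). The product, unit and involution of a module algebra
are then carried over to sections, and from there to the fibres.
-/

/-! ### Finite global frames -/

section Frames

variable {E : Type*} [NormedAddCommGroup E] [NormedSpace ℝ E]
  {H : Type*} [TopologicalSpace H] {I : ModelWithCorners ℝ E H}
  {M : Type u} [TopologicalSpace M] [ChartedSpace H M]

theorem ContMDiffAt.complex_smul {m : ℕ} {x₀ : M} {f : M → ℂ} {g : M → Fin m → ℂ}
    (hf : ContMDiffAt I 𝓘(ℝ, ℂ) ∞ f x₀) (hg : ContMDiffAt I 𝓘(ℝ, Fin m → ℂ) ∞ g x₀) :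
    ContMDiffAt I 𝓘(ℝ, Fin m → ℂ) ∞ (fun x => f x • g x) x₀ := by
  rw [contMDiffAt_pi_space] at hg ⊢
  exact fun a => hf.mul (hg a)

theorem ContMDiffAt.complex_smul_of_tsupport_subset {m : ℕ} {x₀ : M} {U : Set M} {f : M → ℂ}
    {g : M → Fin m → ℂ} (hf : ContMDiffAt I 𝓘(ℝ, ℂ) ∞ f x₀) (hfU : tsupport f ⊆ U)
    (hg : x₀ ∈ U → ContMDiffAt I 𝓘(ℝ, Fin m → ℂ) ∞ g x₀) :
    ContMDiffAt I 𝓘(ℝ, Fin m → ℂ) ∞ (fun x => f x • g x) x₀ := by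
  by_cases h : x₀ ∈ U
  · exact hf.complex_smul (hg h)
  · have h0 : f =ᶠ[nhds x₀] 0 := notMem_tsupport_iff_eventuallyEq.1 fun h' => h (hfU h')
    refine (contMDiffAt_const (c := (0 : Fin m → ℂ))).congr_of_eventuallyEq ?_
    filter_upwards [h0] with y hy
    simp [hy]

theorem exists_contMDiff_eq_one_tsupport_subset [FiniteDimensional ℝ E] [IsManifold I ∞ M]
    [T2Space M] {U : Set M} (hU : IsOpen U) {x : M} (hx : x ∈ U) :
    ∃ h : M → ℝ, ContMDiff I 𝓘(ℝ, ℝ) ∞ h ∧ h x = 1 ∧ tsupport h ⊆ U := by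
  obtain ⟨f, -, hf⟩ :=
    (SmoothBumpFunction.nhds_basis_tsupport (I := I) x).mem_iff.1 (hU.mem_nhds hx)
  exact ⟨f, f.contMDiff, f.eq_one, hf⟩

/-- Subordinate to a cover of a compact manifold there is a "partition of unity" whose members are
products `ρ x * τ x` of two functions with support in `U x`. Two factors are needed since one is
spent on extending a local frame by zero, the other on extending its coefficients. -/
theorem exists_sum_mul_eq_one [FiniteDimensional ℝ E] [IsManifold I ∞ M]
    [T2Space M] [CompactSpace M] (U : M → Set M) (hU : ∀ x, IsOpen (U x)) (hx : ∀ x, x ∈ U x) :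
    ∃ (t : Finset M) (ρ τ : M → SmoothFun I M), (∀ x, tsupport (ρ x) ⊆ U x) ∧
      (∀ x, tsupport (τ x) ⊆ U x) ∧ ∀ y, ∑ x ∈ t, ρ x y * τ x y = 1 := by
  choose h hs h1 hsupp using fun x =>
    exists_contMDiff_eq_one_tsupport_subset (I := I) (hU x) (hx x)
  obtain ⟨t, ht⟩ := CompactSpace.elim_nhds_subcover (fun x => {y | h x y ≠ 0}) fun x =>
    (isOpen_ne_fun (hs x).continuous continuous_const).mem_nhds (by simp [h1])
  let g : M → ℝ := fun y => ∑ x ∈ t, h x y * h x y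
  have hg : ∀ y, g y ≠ 0 := by
    intro y
    have hy : y ∈ ⋃ x ∈ t, {y | h x y ≠ 0} := by rw [ht]; trivial
    simp only [Set.mem_iUnion] at hy
    obtain ⟨x, hxt, hxy⟩ := hy
    exact (Finset.sum_pos' (fun x _ => mul_self_nonneg (h x y))
      ⟨x, hxt, mul_self_pos.2 hxy⟩).ne'
  have hgs : ContMDiff I 𝓘(ℝ, ℝ) ∞ g := fun y =>
    contMDiffAt_finsetSum fun x _ => ((hs x).mul (hs x)) y
  have hgi : ContMDiff I 𝓘(ℝ, ℝ) ∞ fun y => (g y)⁻¹ := fun y => (hgs y).inv₀ (hg y)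
  have hof : ContMDiff 𝓘(ℝ, ℝ) 𝓘(ℝ, ℂ) ∞ Complex.ofReal :=
    Complex.ofRealCLM.contDiff.contMDiff
  refine ⟨t, fun x => ⟨fun y => (h x y : ℂ), hof.comp (hs x)⟩,
    fun x => ⟨fun y => ((h x y * (g y)⁻¹ : ℝ) : ℂ), hof.comp ((hs x).mul hgi)⟩,
    fun x => ?_, fun x => ?_, fun y => ?_⟩
  · exact (tsupport_comp_subset Complex.ofReal_zero (h x)).trans (hsupp x)
  · exact ((tsupport_comp_subset Complex.ofReal_zero _).trans tsupport_mul_subset_left).trans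
      (hsupp x)
  · change ∑ x ∈ t, (h x y : ℂ) * ((h x y * (g y)⁻¹ : ℝ) : ℂ) = 1
    norm_cast
    simp only [← mul_assoc, ← Finset.sum_mul]
    exact mul_inv_cancel₀ (hg y)

/-- A finite global frame of a vector bundle: finitely many smooth sections `sec k`, together with
smooth fibrewise linear functionals `coeff k` such that `p = ∑ₖ coeff k p • sec k x` for every
`p` in the fibre at `x`. The sections span every fibre but need not be linearly independent. -/
structure SmoothVB.Frame (B : SmoothVB I M) where
  /-- The index type. -/
  ι : Type u
  [fintype : Fintype ι]
  /-- The spanning sections. -/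
  sec : ι → SmoothSection B
  /-- The coefficient functionals. -/
  coeff : ι → ∀ x, B.fiber x →ₗ[ℂ] ℂ
  smooth_coeff : ∀ k i v, ContMDiffOn I 𝓘(ℝ, ℂ) ∞ (fun x => coeff k x (B.symm i x v)) (B.dom i)
  sum_coeff_smul : ∀ x p, ∑ k, coeff k x p • sec k x = p

attribute [instance] SmoothVB.Frame.fintype

/-- The section with constant coordinates `v` in a local trivialisation, cut off by a function `f`
with support in the domain and extended by zero. -/
noncomputable def SmoothVB.cutoffSection (B : SmoothVB I M) (i : B.Idx) (f : SmoothFun I M)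
    (hf : tsupport f ⊆ B.dom i) (v : Fin (B.rank i) → ℂ) : SmoothSection B where
  toFun y := f y • B.symm i y v
  smooth j x hx := by
    simp only [map_smul]
    refine (f.contMDiff.contMDiffAt.complex_smul_of_tsupport_subset hf
      fun hi => ?_).contMDiffWithinAt
    exact (B.smooth_coordChange i j v).contMDiffAt
      (((B.isOpen_dom i).inter (B.isOpen_dom j)).mem_nhds ⟨hi, hx⟩)

theorem SmoothVB.nonempty_frame [FiniteDimensional ℝ E] [IsManifold I ∞ M]
    [T2Space M] [CompactSpace M] (B : SmoothVB I M) : Nonempty B.Frame := by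
  choose idx hidx using B.exists_mem_dom
  obtain ⟨t, ρ, τ, hρ, hτ, h1⟩ := exists_sum_mul_eq_one (I := I) (fun x => B.dom (idx x))
    (fun x => B.isOpen_dom _) hidx
  refine ⟨{
    ι := Σ x : t, Fin (B.rank (idx x))
    sec := fun k => B.cutoffSection _ (ρ k.1) (hρ k.1) (Pi.single k.2 1)
    coeff := fun k y => (LinearMap.proj k.2 ∘ₗ B.triv (idx k.1) y).smulRight (τ k.1 y)
    smooth_coeff := ?_
    sum_coeff_smul := ?_ }⟩
  · rintro ⟨x, a⟩ j v y hy
    have := (τ x).contMDiff.contMDiffAt.complex_smul_of_tsupport_subset (hτ x)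
      (g := fun z => B.triv (idx x) z (B.symm j z v)) (x₀ := y) fun hi =>
        (B.smooth_coordChange j (idx x) v).contMDiffAt
          (((B.isOpen_dom j).inter (B.isOpen_dom _)).mem_nhds ⟨hy, hi⟩)
    refine ((contMDiffAt_pi_space.1 this a).congr_of_eventuallyEq ?_).contMDiffWithinAt
    exact Filter.Eventually.of_forall fun z => by simp [mul_comm]
  · intro y p
    -- Outside the domain of the trivialisation both sides vanish, as `ρ x y = 0`.
    have key : ∀ x : M, ∑ a, (B.triv (idx x) y p a * τ x y) •
        (ρ x y • B.symm (idx x) y (Pi.single a 1)) = (ρ x y * τ x y) • p := by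
      intro x
      by_cases hy : y ∈ B.dom (idx x)
      · conv_rhs => rw [← B.symm_triv _ _ hy p, pi_eq_sum_univ' (B.triv (idx x) y p)]
        simp only [map_sum, map_smul, Finset.smul_sum, smul_smul]
        refine Finset.sum_congr rfl fun a _ => ?_
        congr 1
        ring
      · have h0 : ρ x y = 0 := image_eq_zero_of_notMem_tsupport fun h => hy (hρ x h)
        simp [h0]
    rw [Fintype.sum_sigma]
    change ∑ x : t, ∑ a, (B.triv (idx x) y p a * τ x y) •
        (ρ x y • B.symm (idx x) y (Pi.single a 1)) = p
    simp only [key]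
    rw [Finset.sum_coe_sort t fun x => (ρ x y * τ x y) • p, ← Finset.sum_smul, h1, one_smul]

namespace SmoothVB.Frame

variable {B C : SmoothVB I M} (F : B.Frame)

theorem smoothAt_coeff (k : F.ι) {s : ∀ x, B.fiber x} {i : B.Idx} {x : M} (hi : x ∈ B.dom i)
    (hs : ContMDiffAt I 𝓘(ℝ, Fin (B.rank i) → ℂ) ∞ (fun y => B.triv i y (s y)) x) :
    ContMDiffAt I 𝓘(ℝ, ℂ) ∞ (fun y => F.coeff k y (s y)) x := by
  -- The functional is treated as a map to `ℂ ^ 1`, to which `contMDiffAt_linear_apply` applies.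
  have h := contMDiffAt_linear_apply (I := I) (x₀ := x)
    (fun y => LinearMap.pi fun _ : Fin 1 => F.coeff k y ∘ₗ B.symm i y) (fun y => B.triv i y (s y))
    (fun v => contMDiffAt_pi_space.2 fun _ =>
      (F.smooth_coeff k i v).contMDiffAt ((B.isOpen_dom i).mem_nhds hi)) hs
  refine (contMDiffAt_pi_space.1 h 0).congr_of_eventuallyEq ?_
  filter_upwards [(B.isOpen_dom i).mem_nhds hi] with y hy
  simp [B.symm_triv i y hy]

/-- The coefficient functionals as `C^∞(M)`-linear functionals on sections. -/
def secCoeff (k : F.ι) : SmoothSection B →ₗ[SmoothFun I M] SmoothFun I M where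
  toFun s := ⟨fun x => F.coeff k x (s x), fun x => by
    obtain ⟨i, hi⟩ := B.exists_mem_dom x
    exact F.smoothAt_coeff k hi (s.smoothAt hi)⟩
  map_add' s t := by ext x; exact map_add (F.coeff k x) (s x) (t x)
  map_smul' f s := by ext x; exact map_smul (F.coeff k x) (f x) (s x)

theorem _root_.SmoothSection.sum_apply {ι : Type*} (t : Finset ι) (s : ι → SmoothSection B)
    (x : M) : (∑ k ∈ t, s k) x = ∑ k ∈ t, s k x :=
  map_sum (AddMonoidHom.mk' (fun s : SmoothSection B => s x) fun _ _ => rfl) s t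

theorem sum_secCoeff_smul (s : SmoothSection B) : ∑ k, F.secCoeff k s • F.sec k = s :=
  DFunLike.ext _ _ fun x => by
    rw [SmoothSection.sum_apply]
    exact F.sum_coeff_smul x (s x)

/-- The sections of a vector bundle with a finite frame form a direct summand of a finite free
module. -/
theorem isFGP (F : B.Frame) : IsFGP (SmoothFun I M) (SmoothSection B) := by
  have h : (Fintype.linearCombination (SmoothFun I M) F.sec) ∘ₗ LinearMap.pi F.secCoeff =
      LinearMap.id := LinearMap.ext fun s => by
    simpa [Fintype.linearCombination_apply] using F.sum_secCoeff_smul s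
  exact ⟨Module.Finite.of_surjective _ (LinearMap.surjective_of_comp_eq_id _ _ h),
    Module.Projective.of_split _ _ h⟩

theorem exists_section_apply_eq (F : B.Frame) {x : M} (p : B.fiber x) :
    ∃ s : SmoothSection B, s x = p := by
  refine ⟨∑ k, (ContMDiffMap.const (F.coeff k x p) : SmoothFun I M) • F.sec k, ?_⟩
  rw [SmoothSection.sum_apply]
  exact F.sum_coeff_smul x p

/-- If an additive map `T` on sections is semilinear through evaluation of `C^∞(M)` at `x`, then
`T s` depends on the value `s x` only. -/
theorem sum_coeff_smul_map {V : Type*} [AddCommGroup V] [Module ℂ V] {σ : ℂ →+* ℂ} {x : M}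
    (T : SmoothSection B → V) (hadd : ∀ s t, T (s + t) = T s + T t)
    (hsmul : ∀ (f : SmoothFun I M) s, T (f • s) = σ (f x) • T s) (s : SmoothSection B) :
    ∑ k, σ (F.coeff k x (s x)) • T (F.sec k) = T s := by
  conv_rhs => rw [← F.sum_secCoeff_smul s]
  refine Eq.trans ?_ (map_sum (AddMonoidHom.mk' T hadd) _ _).symm
  exact Finset.sum_congr rfl fun k _ => (hsmul (F.secCoeff k s) (F.sec k)).symm

end SmoothVB.Frame

end Frames

/-! ### From operations on sections to operations on fibres -/

section Fibrewise

variable {E : Type*} [NormedAddCommGroup E] [NormedSpace ℝ E]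
  {H : Type*} [TopologicalSpace H] {I : ModelWithCorners ℝ E H}
  {M : Type u} [TopologicalSpace M] [ChartedSpace H M]

namespace SmoothVB.Frame

variable {B C : SmoothVB I M} (F : B.Frame)

/-- The vector bundle morphism inducing a given `C^∞(M)`-linear map of sections. -/
noncomputable def homOfMapSections (T : SmoothSection B →ₗ[SmoothFun I M] SmoothSection C) :
    VBHom B C where
  toFun x := ∑ k, (F.coeff k x).smulRight (T (F.sec k) x)
  smooth i j v x hx := by
    simp only [LinearMap.sum_apply, LinearMap.smulRight_apply, map_sum, map_smul]
    refine (contMDiffAt_finsetSum fun k _ => ?_).contMDiffWithinAt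
    exact ((F.smooth_coeff k i v).contMDiffAt ((B.isOpen_dom i).mem_nhds hx.1)).complex_smul
      ((T (F.sec k)).smoothAt hx.2)

theorem homOfMapSections_apply (T : SmoothSection B →ₗ[SmoothFun I M] SmoothSection C) {x : M}
    (s : SmoothSection B) : (F.homOfMapSections T).toFun x (s x) = T s x := by
  simpa [homOfMapSections, LinearMap.sum_apply] using
    F.sum_coeff_smul_map (σ := RingHom.id ℂ) (fun s => T s x) (by simp) (by simp) s

/-- The fibrewise multiplication inducing a given `C^∞(M)`-bilinear product of sections. -/
noncomputable def fibreMu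
    (m : SmoothSection B →ₗ[SmoothFun I M] SmoothSection B →ₗ[SmoothFun I M] SmoothSection B)
    (x : M) : B.fiber x ⊗[ℂ] B.fiber x →ₗ[ℂ] B.fiber x :=
  TensorProduct.lift (∑ k, (F.coeff k x).smulRight
    (∑ l, (F.coeff l x).smulRight (m (F.sec k) (F.sec l) x)))

theorem fibreMu_tmul
    (m : SmoothSection B →ₗ[SmoothFun I M] SmoothSection B →ₗ[SmoothFun I M] SmoothSection B)
    {x : M} (p q : B.fiber x) : F.fibreMu m x (p ⊗ₜ q) =
      ∑ k, F.coeff k x p • ∑ l, F.coeff l x q • m (F.sec k) (F.sec l) x := by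
  simp [fibreMu, LinearMap.sum_apply]

theorem fibreMu_apply
    (m : SmoothSection B →ₗ[SmoothFun I M] SmoothSection B →ₗ[SmoothFun I M] SmoothSection B)
    {x : M} (s t : SmoothSection B) : F.fibreMu m x (s x ⊗ₜ t x) = m s t x := by
  have h₁ (r : SmoothSection B) : ∑ l, F.coeff l x (t x) • m r (F.sec l) x = m r t x :=
    F.sum_coeff_smul_map (σ := RingHom.id ℂ) (fun t => m r t x) (by simp) (by simp) t
  simp only [fibreMu_tmul, h₁]
  exact F.sum_coeff_smul_map (σ := RingHom.id ℂ) (fun s => m s t x) (by simp) (by simp) s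

/-- The algebra bundle structure inducing a given associative bilinear product of sections. -/
noncomputable abbrev algebraBundleStr
    (m : SmoothSection B →ₗ[SmoothFun I M] SmoothSection B →ₗ[SmoothFun I M] SmoothSection B)
    (hm : ∀ s t r, m (m s t) r = m s (m t r)) : AlgebraBundleStr B where
  mu := F.fibreMu m
  smooth_mu i v w x hx := by
    simp only [fibreMu_tmul, map_sum, map_smul]
    have hc (k : F.ι) (v : Fin (B.rank i) → ℂ) :=
      (F.smooth_coeff k i v).contMDiffAt ((B.isOpen_dom i).mem_nhds hx)
    exact (contMDiffAt_finsetSum fun k _ => (hc k v).complex_smul <|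
      contMDiffAt_finsetSum fun l _ => (hc l w).complex_smul <|
        (m (F.sec k) (F.sec l)).smoothAt hx).contMDiffWithinAt
  mu_assoc x p q r := by
    obtain ⟨s, rfl⟩ := F.exists_section_apply_eq p
    obtain ⟨t, rfl⟩ := F.exists_section_apply_eq q
    obtain ⟨u, rfl⟩ := F.exists_section_apply_eq r
    simp only [fibreMu_apply, hm]

theorem existsUnique_algebraBundleStr (F : B.Frame)
    (m : SmoothSection B →ₗ[SmoothFun I M] SmoothSection B →ₗ[SmoothFun I M] SmoothSection B)
    (hm : ∀ s t r, m (m s t) r = m s (m t r)) :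
    ∃! A : AlgebraBundleStr B, ∀ (s t : SmoothSection B) (x : M),
      A.mu x (s x ⊗ₜ[ℂ] t x) = m s t x := by
  refine ⟨F.algebraBundleStr m hm, fun s t x => F.fibreMu_apply m s t, fun A hA => ?_⟩
  refine AlgebraBundleStr.ext (funext fun x => TensorProduct.ext' fun p q => ?_)
  obtain ⟨s, rfl⟩ := F.exists_section_apply_eq p
  obtain ⟨t, rfl⟩ := F.exists_section_apply_eq q
  exact (hA s t x).trans (F.fibreMu_apply m s t).symm

variable [AlgebraBundleStr B]

/-- The values of a unit of the algebra of sections are units of the fibres. -/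
abbrev unitalBundleStr (F : B.Frame) (e : SmoothSection B) (he : ∀ s, e * s = s ∧ s * e = s) :
    UnitalBundleStr B where
  one := e
  one_mul x p := by
    obtain ⟨s, rfl⟩ := F.exists_section_apply_eq p
    exact DFunLike.congr_fun (he s).1 x
  mul_one x p := by
    obtain ⟨s, rfl⟩ := F.exists_section_apply_eq p
    exact DFunLike.congr_fun (he s).2 x

theorem existsUnique_unitalBundleStr (F : B.Frame) (e : SmoothSection B)
    (he : ∀ s, e * s = s ∧ s * e = s) : ∃! U : UnitalBundleStr B, ∀ x : M, U.one x = e x :=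
  ⟨F.unitalBundleStr e he, fun _ => rfl, fun _ hU => UnitalBundleStr.ext (funext hU)⟩

/-- The fibrewise conjugate-linear map inducing a given conjugate-linear map of sections. -/
noncomputable def fibreJ
    (σ : SmoothSection B →ₛₗ[starRingEnd (SmoothFun I M)] SmoothSection B) (x : M) :
    B.fiber x →ₛₗ[starRingEnd ℂ] B.fiber x where
  toFun p := ∑ k, starRingEnd ℂ (F.coeff k x p) • σ (F.sec k) x
  map_add' p q := by simp [add_smul, Finset.sum_add_distrib]
  map_smul' c p := by simp [mul_smul, Finset.smul_sum]

theorem fibreJ_apply (σ : SmoothSection B →ₛₗ[starRingEnd (SmoothFun I M)] SmoothSection B)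
    {x : M} (s : SmoothSection B) : F.fibreJ σ x (s x) = σ s x :=
  F.sum_coeff_smul_map (σ := starRingEnd ℂ) (fun s => σ s x) (by simp) (by
    intro f s
    rw [map_smulₛₗ]
    rfl) s

/-- The involution of an algebra bundle inducing a given involution of the algebra of sections. -/
noncomputable abbrev involutiveBundleStr
    (σ : SmoothSection B →ₛₗ[starRingEnd (SmoothFun I M)] SmoothSection B)
    (hσ : ∀ s t, σ (s * t) = σ t * σ s) (hσσ : ∀ s, σ (σ s) = s) : InvolutiveBundleStr B where
  J := F.fibreJ σ
  smooth_J i v x hx := by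
    change ContMDiffWithinAt I _ _ (fun x => B.triv i x
      (∑ k, starRingEnd ℂ (F.coeff k x (B.symm i x v)) • σ (F.sec k) x)) _ _
    simp only [map_sum, map_smul]
    refine (contMDiffAt_finsetSum fun k _ => ?_).contMDiffWithinAt
    refine ContMDiffAt.complex_smul ?_ ((σ (F.sec k)).smoothAt hx)
    exact (Complex.conjCLE.contDiff.contMDiff (n := ∞)).contMDiffAt.comp x
      ((F.smooth_coeff k i v).contMDiffAt ((B.isOpen_dom i).mem_nhds hx))
  J_mul x p q := by
    obtain ⟨s, rfl⟩ := F.exists_section_apply_eq p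
    obtain ⟨t, rfl⟩ := F.exists_section_apply_eq q
    rw [← SmoothSection.mul_apply, fibreJ_apply, fibreJ_apply, fibreJ_apply, hσ,
      SmoothSection.mul_apply]
  J_J x p := by
    obtain ⟨s, rfl⟩ := F.exists_section_apply_eq p
    rw [fibreJ_apply, fibreJ_apply, hσσ]

theorem existsUnique_involutiveBundleStr (F : B.Frame)
    (σ : SmoothSection B →ₛₗ[starRingEnd (SmoothFun I M)] SmoothSection B)
    (hσ : ∀ s t, σ (s * t) = σ t * σ s) (hσσ : ∀ s, σ (σ s) = s) :
    ∃! V : InvolutiveBundleStr B, ∀ (s : SmoothSection B) (x : M), V.J x (s x) = σ s x := by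
  refine ⟨F.involutiveBundleStr σ hσ hσσ, fun s x => F.fibreJ_apply σ s, fun V hV => ?_⟩
  refine InvolutiveBundleStr.ext (funext fun x => LinearMap.ext fun p => ?_)
  obtain ⟨s, rfl⟩ := F.exists_section_apply_eq p
  exact (hV s x).trans (F.fibreJ_apply σ s).symm

end SmoothVB.Frame

end Fibrewise

/-! ### The bundle of ranges of a smooth family of idempotents -/

section IdempotentBundle

variable {E : Type*} [NormedAddCommGroup E] [NormedSpace ℝ E]
  {H : Type*} [TopologicalSpace H] {I : ModelWithCorners ℝ E H}
  {M : Type u} [TopologicalSpace M] [ChartedSpace H M]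
  {κ : Type u} [Fintype κ]

/-- An idempotent endomorphism `e` of a finite-dimensional space splits through `ℂ ^ rank e`. -/
theorem exists_split_of_isIdempotentElem {V : Type*} [AddCommGroup V] [Module ℂ V]
    [FiniteDimensional ℂ V] {e : V →ₗ[ℂ] V} (he : ∀ v, e (e v) = e v) :
    ∃ (r : ℕ) (π : V →ₗ[ℂ] (Fin r → ℂ)) (j : (Fin r → ℂ) →ₗ[ℂ] V),
      (∀ v, π (j v) = v) ∧ ∀ v, j (π v) = e v := by
  let b := (Module.finBasis ℂ (LinearMap.range e)).equivFun
  refine ⟨_, b.toLinearMap ∘ₗ e.rangeRestrict, (LinearMap.range e).subtype ∘ₗ b.symm.toLinearMap,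
    fun v => ?_, fun v => by simp⟩
  have h : e.rangeRestrict (b.symm v : V) = b.symm v := by
    obtain ⟨w, hw⟩ := (b.symm v).2
    exact Subtype.ext (by simp [← hw, he])
  simp [h]

theorem ContMDiffAt.complex_clm_apply {V W : Type*} [NormedAddCommGroup V] [NormedSpace ℂ V]
    [NormedAddCommGroup W] [NormedSpace ℂ W] {x₀ : M} {G : M → V →L[ℂ] W} {w : M → V}
    (hG : ContMDiffAt I 𝓘(ℝ, V →L[ℂ] W) ∞ G x₀) (hw : ContMDiffAt I 𝓘(ℝ, V) ∞ w x₀) :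
    ContMDiffAt I 𝓘(ℝ, W) ∞ (fun x => G x (w x)) x₀ :=
  (((ContinuousLinearMap.restrictScalarsL ℂ V W ℝ ℝ).contDiff.contMDiff (n := ∞)).contMDiffAt.comp
    x₀ hG).clm_apply hw

theorem ContMDiffAt.linearMap_comp {V W : Type*} [NormedAddCommGroup V] [NormedSpace ℂ V]
    [FiniteDimensional ℂ V] [NormedAddCommGroup W] [NormedSpace ℂ W] {x₀ : M} (L : V →ₗ[ℂ] W)
    {w : M → V} (hw : ContMDiffAt I 𝓘(ℝ, V) ∞ w x₀) :
    ContMDiffAt I 𝓘(ℝ, W) ∞ (fun x => L (w x)) x₀ :=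
  ContMDiffAt.complex_clm_apply (G := fun _ => LinearMap.toContinuousLinearMap L)
    contMDiffAt_const hw

variable (I κ) in
/-- A smooth family of idempotent endomorphisms of `ℂ ^ κ`, together with a splitting of each of
them. The dimension of the range is not assumed constant. -/
structure IdempotentFamily (M : Type u) [TopologicalSpace M] [ChartedSpace H M] where
  /-- The idempotents. -/
  P : M → (κ → ℂ) →L[ℂ] (κ → ℂ)
  smooth : ContMDiff I 𝓘(ℝ, (κ → ℂ) →L[ℂ] (κ → ℂ)) ∞ P
  idem : ∀ x v, P x (P x v) = P x v
  /-- The ranks. -/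
  rank : M → ℕ
  /-- The projections onto the ranges, in coordinates. -/
  proj : ∀ x, (κ → ℂ) →ₗ[ℂ] (Fin (rank x) → ℂ)
  /-- The inclusions of the ranges, in coordinates. -/
  incl : ∀ x, (Fin (rank x) → ℂ) →ₗ[ℂ] (κ → ℂ)
  proj_incl : ∀ x v, proj x (incl x v) = v
  incl_proj : ∀ x v, incl x (proj x v) = P x v

theorem IdempotentFamily.exists_P_eq (P : M → (κ → ℂ) →L[ℂ] (κ → ℂ))
    (smooth : ContMDiff I 𝓘(ℝ, (κ → ℂ) →L[ℂ] (κ → ℂ)) ∞ P)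
    (idem : ∀ x v, P x (P x v) = P x v) : ∃ D : IdempotentFamily I κ M, D.P = P := by
  choose r π j h₁ h₂ using fun x =>
    exists_split_of_isIdempotentElem (e := (P x : (κ → ℂ) →ₗ[ℂ] (κ → ℂ))) (idem x)
  exact ⟨⟨P, smooth, idem, r, π, j, h₁, h₂⟩, rfl⟩

namespace IdempotentFamily

variable (D : IdempotentFamily I κ M)

/-- The map `P x₀ * P x + (1 - P x₀) * (1 - P x)`, which is the identity at `x = x₀` and carries
the range of `P x` to the range of `P x₀`. It is written as an affine function of `P x`, so that its
smoothness in `x` is immediate. -/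
noncomputable def transition (x₀ x : M) : (κ → ℂ) →L[ℂ] (κ → ℂ) :=
  1 - D.P x₀ + (2 * D.P x₀ - 1) * D.P x

theorem transition_self (x₀ : M) : D.transition x₀ x₀ = 1 := by
  have h : D.P x₀ * D.P x₀ = D.P x₀ := ContinuousLinearMap.ext (D.idem x₀)
  rw [transition, sub_mul, mul_assoc, h, one_mul]
  noncomm_ring

theorem transition_apply_P (x₀ x : M) (v : κ → ℂ) :
    D.transition x₀ x (D.P x v) = D.P x₀ (D.P x v) := by
  simp [transition, D.idem, two_mul]

theorem P_transition_apply (x₀ x : M) (v : κ → ℂ) :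
    D.P x₀ (D.transition x₀ x v) = D.P x₀ (D.P x v) := by
  simp [transition, D.idem, two_mul]

theorem contMDiff_transition (x₀ : M) :
    ContMDiff I 𝓘(ℝ, (κ → ℂ) →L[ℂ] (κ → ℂ)) ∞ (D.transition x₀) :=
  ((contDiff_const.add (contDiff_const.mul contDiff_id)).contMDiff (n := ∞)).comp D.smooth

theorem contMDiffAt_inverse_transition {x₀ x : M} (h : IsUnit (D.transition x₀ x)) :
    ContMDiffAt I 𝓘(ℝ, (κ → ℂ) →L[ℂ] (κ → ℂ)) ∞
      (fun y => Ring.inverse (D.transition x₀ y)) x :=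
  ContMDiffAt.comp x (g := Ring.inverse) (I' := 𝓘(ℝ, (κ → ℂ) →L[ℂ] (κ → ℂ)))
    (by obtain ⟨u, hu⟩ := h; rw [← hu]; exact (contDiffAt_ringInverse ℝ u).contMDiffAt)
    (D.contMDiff_transition x₀ x)

theorem isOpen_setOf_isUnit_transition (x₀ : M) : IsOpen {x | IsUnit (D.transition x₀ x)} :=
  Units.isOpen.preimage (D.contMDiff_transition x₀).continuous

theorem inverse_transition_apply {x₀ x : M} (h : IsUnit (D.transition x₀ x)) (v : κ → ℂ) :
    Ring.inverse (D.transition x₀ x) (D.transition x₀ x v) = v := by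
  rw [← mul_apply_eq_comp, Ring.inverse_mul_cancel _ h]
  rfl

theorem transition_inverse_apply {x₀ x : M} (h : IsUnit (D.transition x₀ x)) (v : κ → ℂ) :
    D.transition x₀ x (Ring.inverse (D.transition x₀ x) v) = v := by
  rw [← mul_apply_eq_comp, Ring.mul_inverse_cancel _ h]
  rfl

theorem proj_P (x : M) (v : κ → ℂ) : D.proj x (D.P x v) = D.proj x v := by
  rw [← D.incl_proj, D.proj_incl]

theorem P_incl (x : M) (v : Fin (D.rank x) → ℂ) : D.P x (D.incl x v) = D.incl x v := by
  rw [← D.incl_proj, D.proj_incl]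

theorem P_coe {x : M} (p : LinearMap.range (D.P x : (κ → ℂ) →ₗ[ℂ] (κ → ℂ))) :
    D.P x (p : κ → ℂ) = p := by
  obtain ⟨_, w, rfl⟩ := p
  exact D.idem x w

theorem P_inverse_transition_incl_proj {x₀ x : M} (h : IsUnit (D.transition x₀ x)) {v : κ → ℂ}
    (hv : D.P x v = v) :
    D.P x (Ring.inverse (D.transition x₀ x) (D.incl x₀ (D.proj x₀ v))) = v := by
  rw [D.incl_proj, ← hv, ← D.transition_apply_P, D.inverse_transition_apply h, D.idem]

theorem proj_P_inverse_transition_incl {x₀ x : M} (h : IsUnit (D.transition x₀ x))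
    (v : Fin (D.rank x₀) → ℂ) :
    D.proj x₀ (D.P x (Ring.inverse (D.transition x₀ x) (D.incl x₀ v))) = v := by
  rw [← D.proj_P, ← D.P_transition_apply, D.transition_inverse_apply h, D.P_incl, D.proj_incl]

theorem smoothAt_P_inverse_transition_incl {x₀ x : M} (h : IsUnit (D.transition x₀ x))
    {w : M → Fin (D.rank x₀) → ℂ} (hw : ContMDiffAt I 𝓘(ℝ, Fin (D.rank x₀) → ℂ) ∞ w x) :
    ContMDiffAt I 𝓘(ℝ, κ → ℂ) ∞
      (fun y => D.P y (Ring.inverse (D.transition x₀ y) (D.incl x₀ (w y)))) x :=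
  (D.smooth x).complex_clm_apply
    ((D.contMDiffAt_inverse_transition h).complex_clm_apply (hw.linearMap_comp (D.incl x₀)))

/-- The vector bundle whose fibre at `x` is the range of `P x`. Near `x₀` it is trivialised by
projecting to the range of `P x₀`. -/
noncomputable def bundle : SmoothVB I M where
  fiber x := LinearMap.range (D.P x : (κ → ℂ) →ₗ[ℂ] (κ → ℂ))
  Idx := M
  dom x₀ := {x | IsUnit (D.transition x₀ x)}
  isOpen_dom := D.isOpen_setOf_isUnit_transition
  exists_mem_dom x := ⟨x, by simp [transition_self]⟩
  rank := D.rank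
  triv x₀ x := D.proj x₀ ∘ₗ Submodule.subtype _
  symm x₀ x := (D.P x : (κ → ℂ) →ₗ[ℂ] (κ → ℂ)).rangeRestrict ∘ₗ
    (Ring.inverse (D.transition x₀ x) : (κ → ℂ) →L[ℂ] (κ → ℂ)).toLinearMap ∘ₗ D.incl x₀
  symm_triv x₀ x hx p := Subtype.ext (D.P_inverse_transition_incl_proj hx (D.P_coe p))
  triv_symm x₀ x hx v := D.proj_P_inverse_transition_incl hx v
  smooth_coordChange x₀ x₁ v _ hx :=
    ((D.smoothAt_P_inverse_transition_incl hx.1 contMDiffAt_const).linearMap_comp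
      (D.proj x₁)).contMDiffWithinAt

/-- The section of the bundle given by a smooth function with values in the ranges. -/
noncomputable def sectionOfFun (w : κ → SmoothFun I M)
    (hw : ∀ x, D.P x (fun a => w a x) = fun a => w a x) : SmoothSection D.bundle where
  toFun x := ⟨fun a => w a x, _, hw x⟩
  smooth x₀ x _ :=
    (ContMDiffAt.linearMap_comp (D.proj x₀) (w := fun x a => w a x)
      (contMDiffAt_pi_space.2 fun a => (w a).contMDiff x)).contMDiffWithinAt

theorem contMDiff_coe_section (s : SmoothSection D.bundle) :
    ContMDiff I 𝓘(ℝ, κ → ℂ) ∞ fun x => (s x).1 := by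
  intro x₀
  obtain ⟨i, hi⟩ := D.bundle.exists_mem_dom x₀
  refine (D.smoothAt_P_inverse_transition_incl hi (s.smoothAt hi)).congr_of_eventuallyEq ?_
  filter_upwards [(D.bundle.isOpen_dom i).mem_nhds hi] with y hy
  exact (D.P_inverse_transition_incl_proj hy (D.P_coe (s y))).symm

end IdempotentFamily

/-- Every finitely generated projective `C^∞(M)`-module is a module of sections. -/
theorem IsFGP.exists_linearEquiv_smoothSection {A : Type u} [AddCommGroup A]
    [Module (SmoothFun I M) A] (hA : IsFGP (SmoothFun I M) A) :
    ∃ B : SmoothVB I M, Nonempty (SmoothSection B ≃ₗ[SmoothFun I M] A) := by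
  classical
  obtain ⟨_, _⟩ := hA
  obtain ⟨n, f₀, g₀, -, -, h₀⟩ := Module.Finite.exists_comp_eq_id_of_projective (SmoothFun I M) A
  -- The index type is lifted since fibres have to live in `Type u`.
  let κ := ULift.{u} (Fin n)
  let l := LinearEquiv.funCongrLeft (SmoothFun I M) (SmoothFun I M) (Equiv.ulift : κ ≃ Fin n)
  let f : (κ → SmoothFun I M) →ₗ[SmoothFun I M] A := f₀ ∘ₗ l.symm.toLinearMap
  let g : A →ₗ[SmoothFun I M] (κ → SmoothFun I M) := l.toLinearMap ∘ₗ g₀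
  have hfg : ∀ a, f (g a) = a := fun a => by
    simpa [f, g] using LinearMap.congr_fun h₀ a
  -- `g ∘ f` is an idempotent matrix with image isomorphic to `A`; evaluating its entries at the
  -- points of `M` gives a smooth family of idempotent endomorphisms of `ℂ ^ κ`.
  let Q : Matrix κ κ (SmoothFun I M) := LinearMap.toMatrix' (g ∘ₗ f)
  have hQ : ∀ w, Q.mulVec w = g (f w) := fun w => LinearMap.toMatrix'_mulVec _ _
  let ev (x : M) : SmoothFun I M →+* ℂ := ContMDiffMap.evalRingHom x
  let L : (κ → κ → ℂ) →ₗ[ℂ] (κ → ℂ) →L[ℂ] (κ → ℂ) :=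
    LinearMap.toContinuousLinearMap.toLinearMap ∘ₗ Matrix.toLin'.toLinearMap ∘ₗ
      (Matrix.ofLinearEquiv ℂ).toLinearMap
  let P : M → (κ → ℂ) →L[ℂ] (κ → ℂ) := fun x => L fun b a => Q b a x
  have hP : ∀ x v, P x v = (Q.map (ev x)).mulVec v := fun _ _ => rfl
  have hPQ : ∀ x (w : κ → SmoothFun I M),
      P x (fun a => w a x) = fun a => g (f w) a x := fun x w => by
    rw [hP, ← hQ]
    exact (funext fun a => RingHom.map_mulVec (ev x) Q w a).symm
  have hQQ : Q * Q = Q := by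
    rw [← LinearMap.toMatrix'_comp]
    exact congrArg LinearMap.toMatrix' (LinearMap.ext fun w => congrArg g (hfg (f w)))
  obtain ⟨D, hD⟩ := IdempotentFamily.exists_P_eq (I := I) P
    (fun x => ContMDiffAt.linearMap_comp L
      (contMDiffAt_pi_space.2 fun b => contMDiffAt_pi_space.2 fun a => (Q b a).contMDiff x))
    fun x v => by rw [hP, hP, Matrix.mulVec_mulVec, ← Matrix.map_mul, hQQ]
  rw [← hD] at hPQ
  let Φ : A →ₗ[SmoothFun I M] SmoothSection D.bundle :=
    { toFun := fun a => D.sectionOfFun (g a) fun x => by rw [hPQ, hfg]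
      map_add' := fun a b => DFunLike.ext _ _ fun x => Subtype.ext <|
        funext fun k => congrArg (fun w : κ → SmoothFun I M => w k x) (map_add g a b)
      map_smul' := fun c a => DFunLike.ext _ _ fun x => Subtype.ext <|
        funext fun k => congrArg (fun w : κ → SmoothFun I M => w k x) (map_smul g c a) }
  refine ⟨D.bundle, ⟨(LinearEquiv.ofBijective Φ ⟨fun a b hab => ?_, fun s => ?_⟩).symm⟩⟩
  · rw [← hfg a, ← hfg b]
    congr 1
    ext c x
    exact congrFun (congrArg Subtype.val (DFunLike.congr_fun hab x)) c
  · let w : κ → SmoothFun I M := fun a =>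
      ⟨fun x => (s x).1 a, contMDiff_pi_space.1 (D.contMDiff_coe_section s) a⟩
    refine ⟨f w, DFunLike.ext _ _ fun x => Subtype.ext ?_⟩
    exact (hPQ x w).symm.trans (D.P_coe (s x))

end IdempotentBundle

/-! ### Morphisms of bundles and of section modules -/

section Equivalences

variable {E : Type*} [NormedAddCommGroup E] [NormedSpace ℝ E]
  {H : Type*} [TopologicalSpace H] {I : ModelWithCorners ℝ E H}
  {M : Type u} [TopologicalSpace M] [ChartedSpace H M]

namespace VBHom

variable {B C : SmoothVB I M}

/-- Sections determine a bundle morphism since they pass through every point. -/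
theorem ext_of_mapSections (F : B.Frame) {φ ψ : VBHom B C}
    (h : ∀ s, φ.mapSections s = ψ.mapSections s) : φ = ψ := by
  refine VBHom.ext (funext fun x => LinearMap.ext fun p => ?_)
  obtain ⟨s, rfl⟩ := F.exists_section_apply_eq p
  exact DFunLike.congr_fun (h s) x

end VBHom

namespace SmoothVB.Frame

variable {B C : SmoothVB I M}

theorem mapSections_homOfMapSections (F : B.Frame)
    (T : SmoothSection B →ₗ[SmoothFun I M] SmoothSection C) (s : SmoothSection B) :
    (F.homOfMapSections T).mapSections s = T s :=
  DFunLike.ext _ _ fun _ => F.homOfMapSections_apply T s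

variable [AlgebraBundleStr B] [AlgebraBundleStr C]

/-- The vector bundle morphism of a multiplicative map of sections, as an algebra bundle
morphism. -/
noncomputable def algBHomOfMapSections (F : B.Frame)
    (T : SmoothSection B →ₗ[SmoothFun I M] SmoothSection C) (hT : ∀ s t, T (s * t) = T s * T t) :
    AlgBHom B C where
  __ := F.homOfMapSections T
  map_mul x p q := by
    obtain ⟨s, rfl⟩ := F.exists_section_apply_eq p
    obtain ⟨t, rfl⟩ := F.exists_section_apply_eq q
    rw [← SmoothSection.mul_apply]
    simp only [homOfMapSections_apply, hT]
    rfl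

theorem homOfMapSections_map_J [InvolutiveBundleStr B] [InvolutiveBundleStr C] (F : B.Frame)
    (T : SmoothSection B →ₗ[SmoothFun I M] SmoothSection C) (hT : ∀ s, T (star s) = star (T s))
    (x : M) (p : B.fiber x) : (F.homOfMapSections T).toFun x (InvolutiveBundleStr.J x p) =
      InvolutiveBundleStr.J x ((F.homOfMapSections T).toFun x p) := by
  obtain ⟨s, rfl⟩ := F.exists_section_apply_eq p
  rw [← SmoothSection.star_apply]
  simp only [homOfMapSections_apply, hT]
  rfl

end SmoothVB.Frame

/-! ### Transport of algebra structures to bundles -/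

section Transport

variable {B : SmoothVB I M}

theorem SmoothVB.Frame.exists_algebraBundleStr_mulEquiv (F : B.Frame) {A : Type u}
    [NonUnitalRing A] [Module (SmoothFun I M) A] [IsScalarTower (SmoothFun I M) A A]
    [SMulCommClass (SmoothFun I M) A A] (Φ : SmoothSection B ≃ₗ[SmoothFun I M] A) :
    ∃ _ : AlgebraBundleStr B, ∀ s t : SmoothSection B, Φ (s * t) = Φ s * Φ t := by
  let m : SmoothSection B →ₗ[SmoothFun I M] SmoothSection B →ₗ[SmoothFun I M] SmoothSection B :=
    ((LinearMap.mul (SmoothFun I M) A).compl₁₂ Φ.toLinearMap Φ.toLinearMap).compr₂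
      Φ.symm.toLinearMap
  have hm : ∀ s t, m s t = Φ.symm (Φ s * Φ t) := fun _ _ => rfl
  obtain ⟨A, hA, -⟩ := F.existsUnique_algebraBundleStr m fun s t r => by simp [hm, mul_assoc]
  refine ⟨A, fun s t => ?_⟩
  rw [← Φ.symm.injective.eq_iff, Φ.symm_apply_apply, ← hm]
  exact DFunLike.ext _ _ (hA s t)

theorem SmoothVB.Frame.exists_unitalBundleStr_map_one (F : B.Frame) [AlgebraBundleStr B]
    {A : Type u} [Ring A] [Module (SmoothFun I M) A] (Φ : SmoothSection B ≃ₗ[SmoothFun I M] A)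
    (hΦ : ∀ s t, Φ (s * t) = Φ s * Φ t) :
    ∃ _ : UnitalBundleStr B, Φ (1 : SmoothSection B) = 1 :=
  ⟨F.unitalBundleStr (Φ.symm 1) fun s => by simp [← Φ.injective.eq_iff, hΦ],
    Φ.apply_symm_apply 1⟩

theorem SmoothVB.Frame.exists_involutiveBundleStr_map_star (F : B.Frame) [AlgebraBundleStr B]
    {A : Type u} [NonUnitalRing A] [StarRing A] [Module (SmoothFun I M) A]
    [StarModule (SmoothFun I M) A] (Φ : SmoothSection B ≃ₗ[SmoothFun I M] A)
    (hΦ : ∀ s t, Φ (s * t) = Φ s * Φ t) :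
    ∃ _ : InvolutiveBundleStr B, ∀ s : SmoothSection B, Φ (star s) = star (Φ s) := by
  let σ : SmoothSection B →ₛₗ[starRingEnd (SmoothFun I M)] SmoothSection B :=
    { toFun := fun s => Φ.symm (star (Φ s))
      map_add' := fun s t => by simp
      map_smul' := fun c s => by simp [star_smul, starRingEnd_apply] }
  have hσ : ∀ s, Φ (σ s) = star (Φ s) := fun s => Φ.apply_symm_apply _
  obtain ⟨V, hV, -⟩ := F.existsUnique_involutiveBundleStr σ
    (fun s t => by simp [← Φ.injective.eq_iff, hσ, hΦ])
    (fun s => by simp [← Φ.injective.eq_iff, hσ])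
  refine ⟨V, fun s => ?_⟩
  rw [← hσ]
  exact congrArg Φ (DFunLike.ext _ _ (hV s))

end Transport

/-! ### The section functors are equivalences -/

theorem CategoryTheory.ObjectProperty.lift_isEquivalence {C D : Type*} [Category C] [Category D]
    (P : ObjectProperty D) (F : C ⥤ D) (hF : ∀ X, P (F.obj X)) [F.Faithful] [F.Full]
    (h : ∀ Y, P Y → ∃ X, Nonempty (F.obj X ≅ Y)) : (P.lift F hF).IsEquivalence where
  essSurj := ⟨fun Y => by
    obtain ⟨X, ⟨e⟩⟩ := h Y.obj Y.property
    exact ⟨X, ⟨P.isoMk e⟩⟩⟩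

variable [FiniteDimensional ℝ E] [IsManifold I ∞ M] [T2Space M] [CompactSpace M]

instance : (sectionFunctor I M).Faithful where
  map_injective {B C φ ψ} h := by
    obtain ⟨F⟩ := B.bundle.nonempty_frame
    exact AlgBHom.ext (congrArg VBHom.toFun (VBHom.ext_of_mapSections F fun s =>
      DFunLike.congr_fun
        (F := SmoothSection B.bundle →ₙₐ[SmoothFun I M] SmoothSection C.bundle) h s))

instance : (sectionFunctor I M).Full where
  map_surjective {B C} T := by
    obtain ⟨F⟩ := B.bundle.nonempty_frame
    let T' : SmoothSection B.bundle →ₙₐ[SmoothFun I M] SmoothSection C.bundle := T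
    let T₀ : SmoothSection B.bundle →ₗ[SmoothFun I M] SmoothSection C.bundle := T'
    exact ⟨F.algBHomOfMapSections T₀ (map_mul T'),
      NonUnitalAlgHom.ext fun s => F.mapSections_homOfMapSections T₀ s⟩

theorem sectionFunctor_essSurj (A : ModAlg (SmoothFun I M)) (hA : ModAlg.fgp _ A) :
    ∃ B, Nonempty ((sectionFunctor I M).obj B ≅ A) := by
  obtain ⟨B, ⟨Φ⟩⟩ := IsFGP.exists_linearEquiv_smoothSection hA
  obtain ⟨F⟩ := B.nonempty_frame
  obtain ⟨_, hΦ⟩ := F.exists_algebraBundleStr_mulEquiv Φ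
  let f : SmoothSection B →ₙₐ[SmoothFun I M] A.carrier :=
    { Φ.toLinearMap with map_mul' := hΦ, map_zero' := map_zero Φ }
  let g : A.carrier →ₙₐ[SmoothFun I M] SmoothSection B :=
    { Φ.symm.toLinearMap with
      map_mul' := fun a b => by simp [← Φ.injective.eq_iff, hΦ]
      map_zero' := map_zero Φ.symm }
  exact ⟨⟨B⟩, ⟨⟨f, g, NonUnitalAlgHom.ext Φ.symm_apply_apply,
    NonUnitalAlgHom.ext Φ.apply_symm_apply⟩⟩⟩

instance : (sectionFunctorU I M).Faithful where
  map_injective {B C φ ψ} h := by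
    obtain ⟨F⟩ := B.bundle.nonempty_frame
    exact UAlgBHom.ext (congrArg VBHom.toFun (VBHom.ext_of_mapSections F fun s =>
      DFunLike.congr_fun (congrArg AlgCat.Hom.hom h) s))

instance : (sectionFunctorU I M).Full where
  map_surjective {B C} T := by
    obtain ⟨F⟩ := B.bundle.nonempty_frame
    let T' : SmoothSection B.bundle →ₐ[SmoothFun I M] SmoothSection C.bundle := T.hom
    let T₀ : SmoothSection B.bundle →ₗ[SmoothFun I M] SmoothSection C.bundle := T'.toLinearMap
    exact ⟨{ F.algBHomOfMapSections T₀ (map_mul T') with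
      map_one := fun x =>
        (F.homOfMapSections_apply T₀ 1).trans (DFunLike.congr_fun (map_one T') x) },
      AlgCat.Hom.ext (AlgHom.ext fun s => F.mapSections_homOfMapSections T₀ s)⟩

theorem sectionFunctorU_essSurj (A : AlgCat.{u} (SmoothFun I M)) (hA : AlgCat.fgp _ A) :
    ∃ B, Nonempty ((sectionFunctorU I M).obj B ≅ A) := by
  obtain ⟨B, ⟨Φ⟩⟩ := IsFGP.exists_linearEquiv_smoothSection hA
  obtain ⟨F⟩ := B.nonempty_frame
  obtain ⟨_, hΦ⟩ := F.exists_algebraBundleStr_mulEquiv Φ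
  obtain ⟨_, h1⟩ := F.exists_unitalBundleStr_map_one Φ hΦ
  exact ⟨⟨B⟩, ⟨(AlgEquiv.ofLinearEquiv Φ h1 hΦ).toAlgebraIso⟩⟩

instance : (sectionFunctorStar I M).Faithful where
  map_injective {B C φ ψ} h := by
    obtain ⟨F⟩ := B.bundle.nonempty_frame
    exact StarAlgBHom.ext (congrArg VBHom.toFun (VBHom.ext_of_mapSections F fun s =>
      DFunLike.congr_fun
        (F := SmoothSection B.bundle →⋆ₙₐ[SmoothFun I M] SmoothSection C.bundle) h s))

instance : (sectionFunctorStar I M).Full where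
  map_surjective {B C} T := by
    obtain ⟨F⟩ := B.bundle.nonempty_frame
    let T' : SmoothSection B.bundle →⋆ₙₐ[SmoothFun I M] SmoothSection C.bundle := T
    let T₀ : SmoothSection B.bundle →ₗ[SmoothFun I M] SmoothSection C.bundle :=
      T'.toNonUnitalAlgHom
    exact ⟨{ F.algBHomOfMapSections T₀ (map_mul T') with
      map_J := F.homOfMapSections_map_J T₀ (map_star T') },
      NonUnitalStarAlgHom.ext fun s => F.mapSections_homOfMapSections T₀ s⟩

theorem sectionFunctorStar_essSurj (A : StarModAlg (SmoothFun I M)) (hA : StarModAlg.fgp _ A) :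
    ∃ B, Nonempty ((sectionFunctorStar I M).obj B ≅ A) := by
  obtain ⟨B, ⟨Φ⟩⟩ := IsFGP.exists_linearEquiv_smoothSection hA
  obtain ⟨F⟩ := B.nonempty_frame
  obtain ⟨_, hΦ⟩ := F.exists_algebraBundleStr_mulEquiv Φ
  obtain ⟨_, hs⟩ := F.exists_involutiveBundleStr_map_star Φ hΦ
  let f : SmoothSection B →⋆ₙₐ[SmoothFun I M] A.carrier :=
    { Φ.toLinearMap with map_mul' := hΦ, map_zero' := map_zero Φ, map_star' := hs }
  let g : A.carrier →⋆ₙₐ[SmoothFun I M] SmoothSection B :=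
    { Φ.symm.toLinearMap with
      map_mul' := fun a b => by simp [← Φ.injective.eq_iff, hΦ]
      map_zero' := map_zero Φ.symm
      map_star' := fun a => by simp [← Φ.injective.eq_iff, hs] }
  exact ⟨⟨B⟩, ⟨⟨f, g, NonUnitalStarAlgHom.ext Φ.symm_apply_apply,
    NonUnitalStarAlgHom.ext Φ.apply_symm_apply⟩⟩⟩

instance : (sectionFunctorUStar I M).Faithful where
  map_injective {B C φ ψ} h := by
    obtain ⟨F⟩ := B.bundle.nonempty_frame
    exact UStarAlgBHom.ext (congrArg VBHom.toFun (VBHom.ext_of_mapSections F fun s =>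
      DFunLike.congr_fun
        (F := SmoothSection B.bundle →⋆ₐ[SmoothFun I M] SmoothSection C.bundle) h s))

instance : (sectionFunctorUStar I M).Full where
  map_surjective {B C} T := by
    obtain ⟨F⟩ := B.bundle.nonempty_frame
    let T' : SmoothSection B.bundle →⋆ₐ[SmoothFun I M] SmoothSection C.bundle := T
    let T₀ : SmoothSection B.bundle →ₗ[SmoothFun I M] SmoothSection C.bundle :=
      T'.toAlgHom.toLinearMap
    exact ⟨{ F.algBHomOfMapSections T₀ (map_mul T') with
      map_one := fun x =>
        (F.homOfMapSections_apply T₀ 1).trans (DFunLike.congr_fun (map_one T') x)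
      map_J := F.homOfMapSections_map_J T₀ (map_star T') },
      StarAlgHom.ext fun s => F.mapSections_homOfMapSections T₀ s⟩

theorem sectionFunctorUStar_essSurj (A : UStarModAlg (SmoothFun I M))
    (hA : UStarModAlg.fgp _ A) : ∃ B, Nonempty ((sectionFunctorUStar I M).obj B ≅ A) := by
  obtain ⟨B, ⟨Φ⟩⟩ := IsFGP.exists_linearEquiv_smoothSection hA
  obtain ⟨F⟩ := B.nonempty_frame
  obtain ⟨_, hΦ⟩ := F.exists_algebraBundleStr_mulEquiv Φ
  obtain ⟨_, h1⟩ := F.exists_unitalBundleStr_map_one Φ hΦ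
  obtain ⟨_, hs⟩ := F.exists_involutiveBundleStr_map_star Φ hΦ
  let f : SmoothSection B →⋆ₐ[SmoothFun I M] A.carrier :=
    { AlgHom.ofLinearMap Φ.toLinearMap h1 hΦ with map_star' := hs }
  let g : A.carrier →⋆ₐ[SmoothFun I M] SmoothSection B :=
    { AlgHom.ofLinearMap Φ.symm.toLinearMap
        (by simp [← Φ.injective.eq_iff, h1])
        (fun a b => by simp [← Φ.injective.eq_iff, hΦ]) with
      map_star' := fun a => by
        change Φ.symm (star a) = star (Φ.symm a)
        simp [← Φ.injective.eq_iff, hs] }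
  exact ⟨⟨B⟩, ⟨⟨f, g, StarAlgHom.ext Φ.symm_apply_apply, StarAlgHom.ext Φ.apply_symm_apply⟩⟩⟩

end Equivalences

/-- **Serre–Swan theorem for algebra bundles.** -/
theorem mainTheorem5 {E : Type*} [NormedAddCommGroup E] [NormedSpace ℝ E] [FiniteDimensional ℝ E]
    {H : Type*} [TopologicalSpace H] (I : ModelWithCorners ℝ E H)
    (M : Type u) [TopologicalSpace M] [ChartedSpace H M] [IsManifold I ∞ M]
    [CompactSpace M] [T2Space M] :
    -- The section functor takes values in finitely generated projective module algebras and is an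
    -- equivalence onto their category: for algebra bundles,
    (∃ h : ∀ B : AlgB I M, ModAlg.fgp (SmoothFun I M) ((sectionFunctor I M).obj B),
      ((ModAlg.fgp (SmoothFun I M)).lift (sectionFunctor I M) h).IsEquivalence) ∧
    -- for unital algebra bundles,
    (∃ h : ∀ B : UAlgB I M, AlgCat.fgp (SmoothFun I M) ((sectionFunctorU I M).obj B),
      ((AlgCat.fgp (SmoothFun I M)).lift (sectionFunctorU I M) h).IsEquivalence) ∧
    -- for involutive algebra bundles,
    (∃ h : ∀ B : StarAlgB I M, StarModAlg.fgp (SmoothFun I M) ((sectionFunctorStar I M).obj B),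
      ((StarModAlg.fgp (SmoothFun I M)).lift (sectionFunctorStar I M) h).IsEquivalence) ∧
    -- and for unital involutive algebra bundles.
    (∃ h : ∀ B : UStarAlgB I M, UStarModAlg.fgp (SmoothFun I M) ((sectionFunctorUStar I M).obj B),
      ((UStarModAlg.fgp (SmoothFun I M)).lift (sectionFunctorUStar I M) h).IsEquivalence) ∧
    -- Every module algebra structure on the module of sections of a vector bundle comes from a
    -- unique algebra bundle structure,
    (∀ (B : SmoothVB I M)
      (m : SmoothSection B →ₗ[SmoothFun I M] SmoothSection B →ₗ[SmoothFun I M] SmoothSection B),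
      (∀ s t r, m (m s t) r = m s (m t r)) →
      ∃! A : AlgebraBundleStr B, ∀ (s t : SmoothSection B) (x : M),
        A.mu x (s x ⊗ₜ[ℂ] t x) = m s t x) ∧
    -- every unit of the algebra of sections is given by units of the fibres,
    (∀ (B : SmoothVB I M) [AlgebraBundleStr B] (e : SmoothSection B),
      (∀ s, e * s = s ∧ s * e = s) →
      ∃! U : UnitalBundleStr B, ∀ x : M, U.one x = e x) ∧
    -- and every involution on the algebra of sections comes from a unique involution of the bundle.
    (∀ (B : SmoothVB I M) [AlgebraBundleStr B]
      (σ : SmoothSection B →ₛₗ[starRingEnd (SmoothFun I M)] SmoothSection B),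
      (∀ s t, σ (s * t) = σ t * σ s) → (∀ s, σ (σ s) = s) →
      ∃! V : InvolutiveBundleStr B, ∀ (s : SmoothSection B) (x : M), V.J x (s x) = σ s x) := by
  have hfgp (B : SmoothVB I M) : IsFGP (SmoothFun I M) (SmoothSection B) :=
    B.nonempty_frame.elim fun F => F.isFGP
  refine ⟨⟨fun B => hfgp B.bundle, ?_⟩, ⟨fun B => hfgp B.bundle, ?_⟩, ⟨fun B => hfgp B.bundle, ?_⟩,
    ⟨fun B => hfgp B.bundle, ?_⟩, fun B m hm => ?_, fun B _ e he => ?_, fun B _ σ hσ hσσ => ?_⟩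
  · exact ObjectProperty.lift_isEquivalence _ _ _ sectionFunctor_essSurj
  · exact ObjectProperty.lift_isEquivalence _ _ _ sectionFunctorU_essSurj
  · exact ObjectProperty.lift_isEquivalence _ _ _ sectionFunctorStar_essSurj
  · exact ObjectProperty.lift_isEquivalence _ _ _ sectionFunctorUStar_essSurj
  · exact B.nonempty_frame.elim fun F => F.existsUnique_algebraBundleStr m hm
  · exact B.nonempty_frame.elim fun F => F.existsUnique_unitalBundleStr e he
  · exact B.nonempty_frame.elim fun F => F.existsUnique_involutiveBundleStr σ hσ hσσ
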